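/- Let $k$ be an algebraically closed field of characteristic zero, and let $R=k[x_0,x_1,x_2]$. A monomial Togliatti system of forms of degree $d$ in $R$ is an artinian ideal $I$ generated by $r\le d+1$ monomials of degree $d$ which fails the weak Lefschetz property in degree $d-1$: for the general (equivalently, for every) linear form $L$, the multiplication map $\times L\colon (R/I)_{d-1}\to (R/I)_d$ is neither injective nor surjective. It is minimal if no proper subset of its set of $d$-ic monomial generators generates a monomial Togliatti system. It is smooth if the projective variety $X$ is smooth, where $X$ is the closure of the image of the rational map from $\mathbb{P}^2$ given by all monomials of degree $d$ not in $I$. Let $\mathcal{T}(2,d)$ be the set of minimal monomial Togliatti systems of forms of degree $d$ in $R$, and $\mathcal{T}^s(2,d)\subset\mathcal{T}(2,d)$ the subset of the smooth ones. Let $\mu(I)$ be the minimal number of generators of $I$, let $\mu(2,d)$ and $\rho(2,d)$ be the minimum and the maximum of $\mu(I)$ over $I\in\mathcal{T}(2,d)$, and let $\mu^s(2,d)$ and $\rho^s(2,d)$ be the minimum and the maximum of $\mu(I)$ over $I\in\mathcal{T}^s(2,d)$. Proposition 4.1. Let $d\ge 4$. Then: (i) $\mu^s(2,d)=\mu(2,d)=5$.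 (ii) $\rho^s(2,d)=\rho(2,d)=d+1$. (iii) For every integer $r$ with $5\le r\le d+1$ there exists $I\in\mathcal{T}^s(2,d)$ with $\mu(I)=r$. Explicitly, one can take $I=I_r$, where $$I_5=(x_0^d,x_1^d,x_2^d)+x_0^{d-1}(x_1,x_2),$$ and, for $r>5$, $$I_r=(x_0^d,x_1^d,x_2^d)+x_0^{d-r+3}x_1x_2\,(x_0^{r-5},\,x_0^{r-6}x_1,\,\dots,\,x_0x_1^{r-6},\,x_1^{r-5},\,x_2^{r-5}).$$ -/

import Mathlib

noncomputable section

namespace Togliatti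

open MvPolynomial

variable {k : Type*} [Field k] {n : ℕ}

/-! ### The weak Lefschetz property -/

/-- The graded piece `(R/I)_j` of `R/I`, where `R = k[x_0, …, x_n]`: the classes of the forms of
degree `j`. -/
def gradedPiece (I : Ideal (MvPolynomial (Fin (n + 1)) k)) (j : ℕ) :
    Submodule k (MvPolynomial (Fin (n + 1)) k ⧸ I) :=
  (homogeneousSubmodule (Fin (n + 1)) k j).map (Ideal.Quotient.mkₐ k I).toLinearMap

/-- Multiplication by `L`, as a map `(R/I)_j → (R/I)_{j+1}`, is injective or surjective. -/
def HasMaximalRank (I : Ideal (MvPolynomial (Fin (n + 1)) k)) (j : ℕ)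
    (L : MvPolynomial (Fin (n + 1)) k) : Prop :=
  Set.InjOn (fun u => Ideal.Quotient.mk I L * u) (gradedPiece I j : Set _) ∨
    Set.SurjOn (fun u => Ideal.Quotient.mk I L * u)
      (gradedPiece I j : Set _) (gradedPiece I (j + 1) : Set _)

/-- `I` fails the weak Lefschetz property in degree `j`: for no linear form `L` does the map
`×L : (R/I)_j → (R/I)_{j+1}` have maximal rank. (Having maximal rank is an open condition on `L`,
so that this is the same as failure for the general linear form.) -/
def FailsWLP (I : Ideal (MvPolynomial (Fin (n + 1)) k)) (j : ℕ) : Prop :=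
  ∀ L : MvPolynomial (Fin (n + 1)) k, L.IsHomogeneous 1 → ¬ HasMaximalRank I j L

/-! ### Togliatti systems -/

/-- `I` is a Togliatti system of forms of degree `d`: an artinian ideal generated by `r` forms of
degree `d`, with `r ≤ binom (n+d-1) (n-1)`, which fails the weak Lefschetz property in degree
`d - 1`. -/
def IsTogliatti (d : ℕ) (I : Ideal (MvPolynomial (Fin (n + 1)) k)) : Prop :=
  (∃ (r : ℕ) (F : Fin r → MvPolynomial (Fin (n + 1)) k),
    r ≤ (n + d - 1).choose (n - 1) ∧ (∀ i, (F i).IsHomogeneous d) ∧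
      I = Ideal.span (Set.range F)) ∧
  IsArtinianRing (MvPolynomial (Fin (n + 1)) k ⧸ I) ∧
  FailsWLP I (d - 1)

variable (k) in
/-- The ideal generated by the monomials `x^a`, `a ∈ S`. -/
def monomialIdeal (S : Finset (Fin (n + 1) →₀ ℕ)) : Ideal (MvPolynomial (Fin (n + 1)) k) :=
  Ideal.span ((fun a => monomial a (1 : k)) '' (S : Set (Fin (n + 1) →₀ ℕ)))

/-- `I` is a minimal monomial Togliatti system of forms of degree `d`: it is a Togliatti system
generated by a finite set of monomials of degree `d` no proper subset of which generates a
Togliatti system. -/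
def IsMinimalMonomialTogliatti (d : ℕ) (I : Ideal (MvPolynomial (Fin (n + 1)) k)) : Prop :=
  ∃ S : Finset (Fin (n + 1) →₀ ℕ), (∀ a ∈ S, a.degree = d) ∧ I = monomialIdeal k S ∧
    IsTogliatti d I ∧ ∀ T ⊂ S, ¬ IsTogliatti d (monomialIdeal k T)

/-! ### The apolar toric variety and its smoothness -/

open Classical in
/-- The set `A_I` of exponents of the monomials of degree `d` that are not in `I`. For a monomial
ideal `I` these monomials form a basis of the degree `d` part of the inverse system. -/
def apolarExponents (d : ℕ) (I : Ideal (MvPolynomial (Fin (n + 1)) k)) :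
    Finset (Fin (n + 1) →₀ ℕ) :=
  ((Finset.univ : Finset (Fin (n + 1))).finsuppAntidiag d).filter
    fun a => monomial a (1 : k) ∉ I

/-- The map `k^{n+1} → k^A`, `x ↦ (x^a)_{a ∈ A}`. -/
def monomialMap (A : Finset (Fin (n + 1) →₀ ℕ)) (x : Fin (n + 1) → k) : A → k :=
  fun a => ∏ i, x i ^ (a.1 i)

variable (k) in
/-- The vanishing ideal of the image of `monomialMap A`. If all the exponents in `A` have the same
degree `d ≥ 1` (and `k` is algebraically closed), that image is the affine cone over the image of
the rational map `ℙ^n ⇢ ℙ(k^A)` given by the monomials `x^a`, `a ∈ A`, and the ideal is the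
homogeneous ideal of the closure `X_A` of the image of this rational map. -/
def coneIdeal (A : Finset (Fin (n + 1) →₀ ℕ)) : Ideal (MvPolynomial A k) :=
  vanishingIdeal k (Set.range (monomialMap (k := k) A))

/-- The Zariski tangent space at `y` of the affine cone over `X_A`. -/
def tangentSpace (A : Finset (Fin (n + 1) →₀ ℕ)) (y : A → k) : Submodule k (A → k) where
  carrier := {v | ∀ f ∈ coneIdeal k A, ∑ a, eval y (pderiv a f) * v a = 0}
  zero_mem' := by intro f _; simp
  add_mem' := by
    intro v w hv hw f hf
    simp only [Pi.add_apply, mul_add, Finset.sum_add_distrib]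
    rw [hv f hf, hw f hf, add_zero]
  smul_mem' := by
    intro c v hv f hf
    have h := congrArg (c * ·) (hv f hf)
    simpa [Finset.mul_sum, mul_left_comm] using h

variable (k) in
/-- The projective variety `X_A ⊆ ℙ(k^A)` is smooth (Jacobian criterion): at every nonzero point
of the affine cone over `X_A`, i.e. at every representative of every point of `X_A`, the Zariski
tangent space of the cone has the dimension of the cone (`dim X_A + 1`), which is the transcendence
degree over `k` of the homogeneous coordinate ring of `X_A`. -/
def IsSmoothToric (A : Finset (Fin (n + 1) →₀ ℕ)) : Prop :=
  ∀ y ∈ zeroLocus k (coneIdeal k A), y ≠ 0 →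
    Module.rank k (tangentSpace A y) = Algebra.trdeg k (MvPolynomial A k ⧸ coneIdeal k A)

/-! ### The sets of systems, and the explicit examples -/

variable (k n) in
/-- The set `𝒯(n,d)` of minimal monomial Togliatti systems of forms of degree `d` in
`k[x_0, …, x_n]`. -/
def systems (d : ℕ) : Set (Ideal (MvPolynomial (Fin (n + 1)) k)) :=
  {I | IsMinimalMonomialTogliatti d I}

variable (k n) in
/-- The set `𝒯ˢ(n,d)` of smooth minimal monomial Togliatti systems of forms of degree `d` in
`k[x_0, …, x_n]`. -/
def smoothSystems (d : ℕ) : Set (Ideal (MvPolynomial (Fin (n + 1)) k)) :=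
  {I | IsMinimalMonomialTogliatti d I ∧ IsSmoothToric k (apolarExponents d I)}

/-- The minimal number of generators of an ideal. -/
def numGens (I : Ideal (MvPolynomial (Fin (n + 1)) k)) : ℕ := Submodule.spanFinrank I

variable (k) in
/-- The ideal `I_5 = (x_0^d, x_1^d, x_2^d) + x_0^{d-1} (x_1, x_2)` and, for `5 < r ≤ d + 1`, the
ideal `I_r = (x_0^d, x_1^d, x_2^d) +
x_0^{d-r+3} x_1 x_2 (x_0^{r-5}, x_0^{r-6} x_1, …, x_0 x_1^{r-6}, x_1^{r-5}, x_2^{r-5})`. -/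
def explicitIdeal (d r : ℕ) : Ideal (MvPolynomial (Fin (2 + 1)) k) :=
  Ideal.span {X 0 ^ d, X 1 ^ d, X 2 ^ d} ⊔
    if r = 5 then Ideal.span {X 0 ^ (d - 1) * X 1, X 0 ^ (d - 1) * X 2}
    else Ideal.span {X 0 ^ (d + 3 - r) * X 1 * X 2} *
      Ideal.span ({p | ∃ i j : ℕ, i + j = r - 5 ∧ p = X 0 ^ i * X 1 ^ j} ∪ {X 2 ^ (r - 5)})

end Togliatti

end

/-!
For monomials `S` of degree `d` the system fails the weak Lefschetz property exactly if, on every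
line `L = 0` of the plane, the members of `S` become linearly dependent. On the line
`x_0 + x_1 + x_2 = 0`, with coordinate `t`, a dependency is a vanishing combination of the
polynomials `t^a (-(1 + t))^c`. Comparing `t`-adic orders, in each of the three variables in turn,
shows that at least two generators besides the pure powers are needed, and that for the explicit
systems the dependency is unique up to scalars and involves all the other generators.

The remaining exponents of the explicit systems fill the triangle of exponents with its corners cut
off, or at least all six sides of it. At each vertex of this hexagon the two sides start with a
basis of the lattice, so that near a torus fixed point the variety is an affine space. Every point
lies in one of these charts because an equality `(p + q) a = p b + q c` between exponents gives
`y_a ^ (p + q) = y_b ^ p * y_c ^ q` on the variety. Tangent vectors are points over the dual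
numbers, and can be read off in a chart.
-/

noncomputable section

namespace Togliatti

open MvPolynomial Finset.HasAntidiagonal

variable {k : Type*} [Field k] {n : ℕ}

/-! ### Monomial ideals generated in one degree -/

theorem eq_of_le_of_degree_eq {σ : Type*} {a b : σ →₀ ℕ} (hab : a ≤ b)
    (h : a.degree = b.degree) : a = b := by
  obtain ⟨c, rfl⟩ := exists_add_of_le hab
  have hc : c.degree = 0 := by simpa only [map_add, left_eq_add] using h
  rw [(Finsupp.degree_eq_zero_iff c).1 hc, add_zero]

theorem degree_eq_of_mem_support {σ R : Type*} [CommSemiring R] {f : MvPolynomial σ R} {d : ℕ}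
    (hf : f.IsHomogeneous d) {b : σ →₀ ℕ} (hb : b ∈ f.support) : b.degree = d :=
  of_not_not fun h => mem_support_iff.1 hb (hf.coeff_eq_zero h)

theorem isHomogeneous_of_mem_restrictSupport {σ R : Type*} [CommSemiring R]
    {S : Set (σ →₀ ℕ)} {d : ℕ} (hS : ∀ a ∈ S, a.degree = d) {f : MvPolynomial σ R}
    (hf : f ∈ restrictSupport R S) : f.IsHomogeneous d := by
  rw [← mem_homogeneousSubmodule, homogeneousSubmodule_eq_finsupp_supported]
  exact restrictSupport_mono R hS hf

theorem mem_monomialIdeal_iff {S : Finset (Fin (n + 1) →₀ ℕ)} {f : MvPolynomial (Fin (n + 1)) k} :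
    f ∈ monomialIdeal k S ↔ ∀ b ∈ f.support, ∃ a ∈ S, a ≤ b := by
  simp [monomialIdeal, mem_ideal_span_monomial_image]

theorem monomial_mem_monomialIdeal {S : Finset (Fin (n + 1) →₀ ℕ)} {a : Fin (n + 1) →₀ ℕ}
    (ha : a ∈ S) : monomial a (1 : k) ∈ monomialIdeal k S :=
  Ideal.subset_span ⟨a, ha, rfl⟩

section EqualDegree

variable {S : Finset (Fin (n + 1) →₀ ℕ)} {d : ℕ} (hS : ∀ a ∈ S, a.degree = d)
include hS

theorem mem_monomialIdeal_iff_mem_restrictSupport {f : MvPolynomial (Fin (n + 1)) k}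
    (hf : f.IsHomogeneous d) :
    f ∈ monomialIdeal k S ↔ f ∈ restrictSupport k (S : Set (Fin (n + 1) →₀ ℕ)) := by
  rw [mem_monomialIdeal_iff, mem_restrictSupport_iff]
  refine ⟨fun h b hb => ?_, fun h b hb => ⟨b, h hb, le_rfl⟩⟩
  obtain ⟨a, ha, hab⟩ := h b hb
  rwa [← eq_of_le_of_degree_eq hab ((hS a ha).trans (degree_eq_of_mem_support hf hb).symm)]

theorem eq_zero_of_mem_monomialIdeal {j : ℕ} (hj : j < d) {f : MvPolynomial (Fin (n + 1)) k}
    (hf : f.IsHomogeneous j) (hI : f ∈ monomialIdeal k S) : f = 0 := by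
  refine support_eq_empty.1 (Finset.eq_empty_of_forall_notMem fun b hb => hj.not_ge ?_)
  obtain ⟨a, ha, hab⟩ := mem_monomialIdeal_iff.1 hI b hb
  rw [← hS a ha, ← degree_eq_of_mem_support hf hb]
  exact Finsupp.degree_mono hab

theorem monomial_mem_monomialIdeal_iff {a : Fin (n + 1) →₀ ℕ} (ha : a.degree = d) :
    monomial a (1 : k) ∈ monomialIdeal k S ↔ a ∈ S := by
  rw [mem_monomialIdeal_iff_mem_restrictSupport hS (isHomogeneous_monomial 1 ha),
    monomial_mem_restrictSupport, or_iff_left one_ne_zero, Finset.mem_coe]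

theorem coeff_mul_of_mem_monomialIdeal {a : Fin (n + 1) →₀ ℕ} (ha : a.degree = d)
    (g : MvPolynomial (Fin (n + 1)) k) {f : MvPolynomial (Fin (n + 1)) k}
    (hf : f ∈ monomialIdeal k S) : coeff a (g * f) = coeff 0 g * coeff a f := by
  classical
  rw [coeff_mul, Finset.sum_eq_single (0, a)]
  · rintro ⟨p, q⟩ hpq hne
    have hpq : p + q = a := Finset.HasAntidiagonal.mem_antidiagonal.1 hpq
    suffices q ∉ f.support by rw [notMem_support_iff.1 this, mul_zero]
    intro hq
    obtain ⟨b, hb, hbq⟩ := mem_monomialIdeal_iff.1 hf q hq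
    have hqa : q = a := by
      refine eq_of_le_of_degree_eq (hpq ▸ le_add_self) (le_antisymm ?_ ?_)
      · exact Finsupp.degree_mono (hpq ▸ le_add_self)
      · exact (ha.trans (hS b hb).symm).trans_le (Finsupp.degree_mono hbq)
    exact hne (Prod.ext (by simpa [hqa] using hpq) hqa)
  · simp

/-- Taking the coefficients at `S` turns the `R`-module generators of the ideal into generators
of the vector space `k^S`. -/
theorem card_le_card_of_span_eq_monomialIdeal {G : Finset (MvPolynomial (Fin (n + 1)) k)}
    (hG : Ideal.span (G : Set (MvPolynomial (Fin (n + 1)) k)) = monomialIdeal k S) :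
    S.card ≤ G.card := by
  classical
  let c : MvPolynomial (Fin (n + 1)) k →ₗ[k] S → k := LinearMap.pi fun a => lcoeff k a.1
  have hc (g : MvPolynomial (Fin (n + 1)) k) {f} (hf : f ∈ monomialIdeal k S) :
      c (g * f) = coeff 0 g • c f :=
    funext fun a => coeff_mul_of_mem_monomialIdeal hS (hS a a.2) g hf
  have hmem : ∀ f ∈ monomialIdeal k S, c f ∈ Submodule.span k (G.image c : Set (S → k)) := by
    intro f hf
    rw [← hG] at hf
    induction hf using Submodule.span_induction with
    | mem f hf => exact Submodule.subset_span (Finset.mem_coe.2 (Finset.mem_image_of_mem c hf))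
    | zero => simp
    | add f g _ _ hf hg => rw [map_add]; exact add_mem hf hg
    | smul g f hf h => rw [smul_eq_mul, hc g (hG ▸ hf)]; exact Submodule.smul_mem _ _ h
  have hspan : Submodule.span k (G.image c : Set (S → k)) = ⊤ := by
    refine eq_top_iff.2 ((Pi.basisFun k S).span_eq.ge.trans (Submodule.span_le.2 ?_))
    rintro _ ⟨a, rfl⟩
    have ha : Pi.basisFun k S a = c (monomial a.1 1) := by
      ext b
      simp only [c, Pi.basisFun_apply, LinearMap.pi_apply, lcoeff_apply, coeff_monomial,
        Pi.single_apply]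
      exact if_congr (by rw [Subtype.ext_iff, eq_comm]) rfl rfl
    exact ha ▸ hmem _ (monomial_mem_monomialIdeal a.2)
  calc S.card = Module.finrank k (S → k) := by simp
    _ = Module.finrank k (Submodule.span k (G.image c : Set (S → k))) := by
      rw [hspan, finrank_top]
    _ ≤ (G.image c).card := finrank_span_finset_le_card _
    _ ≤ G.card := Finset.card_image_le

theorem numGens_monomialIdeal : numGens (monomialIdeal k S) = S.card := by
  have hfin : ((fun a => monomial a (1 : k)) '' (S : Set (Fin (n + 1) →₀ ℕ))).Finite :=
    S.finite_toSet.image _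
  apply le_antisymm
  · calc numGens (monomialIdeal k S) ≤ _ := Submodule.spanFinrank_span_le_ncard_of_finite hfin
      _ ≤ _ := Set.ncard_image_le S.finite_toSet
      _ = S.card := Set.ncard_coe_finset S
  · obtain ⟨G, hGcard, hG⟩ :=
      Submodule.FG.exists_span_finset_card_eq_spanFinrank (p := monomialIdeal k S)
        (Submodule.fg_span hfin)
    exact (card_le_card_of_span_eq_monomialIdeal hS hG).trans_eq hGcard

/-- In an artinian quotient some `x_i ^ m - f x_i ^ (m + 1)` vanishes, and `x_i ^ m` is one of its
terms. -/
theorem single_mem_of_isArtinianRing_quotient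
    (h : IsArtinianRing (MvPolynomial (Fin (n + 1)) k ⧸ monomialIdeal k S)) (i : Fin (n + 1)) :
    Finsupp.single i d ∈ S := by
  obtain ⟨m, y, hy⟩ := IsArtinian.exists_pow_succ_smul_dvd
    (Ideal.Quotient.mk (monomialIdeal k S) (X i))
    (1 : MvPolynomial (Fin (n + 1)) k ⧸ monomialIdeal k S)
  obtain ⟨f, rfl⟩ := Ideal.Quotient.mk_surjective y
  have hmem : X i ^ (m + 1) * f - X i ^ m ∈ monomialIdeal k S := by
    rw [← Ideal.Quotient.eq, map_mul, map_pow, map_pow]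
    simpa using hy
  have hsupp : Finsupp.single i m ∈ (X i ^ (m + 1) * f - X i ^ m).support := by
    rw [mem_support_iff, coeff_sub, X_pow_eq_monomial, X_pow_eq_monomial, coeff_monomial_mul',
      if_neg (by simp), coeff_monomial, if_pos rfl, zero_sub]
    exact neg_ne_zero.2 one_ne_zero
  obtain ⟨a, ha, hai⟩ := mem_monomialIdeal_iff.1 hmem _ hsupp
  have ha' : a = Finsupp.single i (a i) := by
    ext j
    rcases eq_or_ne i j with rfl | hij
    · simp
    · simpa [hij] using hai j
  have hd : a i = d := by rw [← hS a ha, ha']; simp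
  rwa [← hd, ← ha']

end EqualDegree

theorem isArtinianRing_quotient_of_single_mem {S : Finset (Fin (n + 1) →₀ ℕ)} {d : ℕ}
    (h : ∀ i, Finsupp.single i d ∈ S) :
    IsArtinianRing (MvPolynomial (Fin (n + 1)) k ⧸ monomialIdeal k S) := by
  let π := Ideal.Quotient.mkₐ k (monomialIdeal k S)
  have hgen : Algebra.adjoin k (π '' Set.range X) = ⊤ := by
    rw [← AlgHom.map_adjoin, adjoin_range_X, Algebra.map_top, AlgHom.range_eq_top]
    exact Ideal.Quotient.mkₐ_surjective _ _
  have hint : ∀ y ∈ π '' Set.range X, IsIntegral k y := by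
    rintro _ ⟨_, ⟨i, rfl⟩, rfl⟩
    have hnil : π (X i) ^ d = 0 := by
      rw [← map_pow, X_pow_eq_monomial]
      exact Ideal.Quotient.eq_zero_iff_mem.2 (monomial_mem_monomialIdeal (h i))
    exact ⟨Polynomial.X ^ d, Polynomial.monic_X_pow d, by rwa [Polynomial.eval₂_X_pow]⟩
  have hfg := fg_adjoin_of_finite ((Set.finite_range X).image π) hint
  rw [hgen] at hfg
  have : Module.Finite k (MvPolynomial (Fin (n + 1)) k ⧸ monomialIdeal k S) := ⟨hfg⟩
  exact IsArtinianRing.of_finite k _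

/-! ### Failure of the weak Lefschetz property -/

theorem finrank_restrictSupport {σ : Type*} (S : Finset (σ →₀ ℕ)) :
    Module.finrank k (restrictSupport k (S : Set (σ →₀ ℕ))) = S.card := by
  rw [Module.finrank_eq_nat_card_basis (basisRestrictSupport k _)]
  simp

theorem homogeneousSubmodule_eq_restrictSupport (j : ℕ) :
    homogeneousSubmodule (Fin (n + 1)) k j =
      restrictSupport k (Finset.univ.finsuppAntidiag j : Finset (Fin (n + 1) →₀ ℕ)) := by
  rw [homogeneousSubmodule_eq_finsupp_supported]
  congr 1
  ext a
  simp [Finsupp.degree_eq_sum]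

theorem finrank_homogeneousSubmodule (j : ℕ) :
    Module.finrank k (homogeneousSubmodule (Fin (n + 1)) k j) = (n + j).choose j := by
  rw [homogeneousSubmodule_eq_restrictSupport, finrank_restrictSupport,
    Finset.card_finsuppAntidiag_nat_eq_choose, Finset.card_univ, Fintype.card_fin,
    Nat.add_right_comm, Nat.add_sub_cancel]

instance finite_homogeneousSubmodule (j : ℕ) :
    Module.Finite k (homogeneousSubmodule (Fin (n + 1)) k j) :=
  Module.Finite.iff_fg.2 (homogeneousSubmodule_fg (Fin (n + 1)) k j)

instance finite_gradedPiece (I : Ideal (MvPolynomial (Fin (n + 1)) k)) (j : ℕ) :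
    Module.Finite k (gradedPiece I j) :=
  inferInstanceAs (Module.Finite k ((homogeneousSubmodule (Fin (n + 1)) k j).map _))

theorem finrank_gradedPiece_add_card {S : Finset (Fin (n + 1) →₀ ℕ)} {d : ℕ}
    (hS : ∀ a ∈ S, a.degree = d) :
    Module.finrank k (gradedPiece (monomialIdeal k S) d) + S.card = (n + d).choose d := by
  let ρ := (Ideal.Quotient.mkₐ k (monomialIdeal k S)).toLinearMap.domRestrict
    (homogeneousSubmodule (Fin (n + 1)) k d)
  have hrange : LinearMap.range ρ = gradedPiece (monomialIdeal k S) d :=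
    LinearMap.range_domRestrict _ _
  have hker : LinearMap.ker ρ = (restrictSupport k (S : Set (Fin (n + 1) →₀ ℕ))).comap
      (homogeneousSubmodule (Fin (n + 1)) k d).subtype := by
    ext ⟨f, hf⟩
    exact Ideal.Quotient.eq_zero_iff_mem.trans (mem_monomialIdeal_iff_mem_restrictSupport hS hf)
  have hle : restrictSupport k (S : Set (Fin (n + 1) →₀ ℕ)) ≤
      homogeneousSubmodule (Fin (n + 1)) k d :=
    fun f hf => isHomogeneous_of_mem_restrictSupport hS hf
  rw [← finrank_homogeneousSubmodule (k := k), ← ρ.finrank_range_add_finrank_ker, hrange, hker,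
    (Submodule.comapSubtypeEquivOfLe hle).finrank_eq, finrank_restrictSupport]

theorem exists_restrictSupport_of_failsWLP {S : Finset (Fin (n + 1) →₀ ℕ)} {j : ℕ}
    (hS : ∀ a ∈ S, a.degree = j + 1) (hW : FailsWLP (monomialIdeal k S) j)
    {L : MvPolynomial (Fin (n + 1)) k} (hL : L.IsHomogeneous 1) :
    ∃ F : MvPolynomial (Fin (n + 1)) k, F.IsHomogeneous j ∧ F ≠ 0 ∧
      L * F ∈ restrictSupport k (S : Set (Fin (n + 1) →₀ ℕ)) := by
  by_contra! hinj
  refine hW L hL (Or.inl ?_)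
  rintro _ ⟨F, hF, rfl⟩ _ ⟨G, hG, rfl⟩ hFG
  have hhom : (F - G).IsHomogeneous j := sub_mem hF hG
  have hmem : L * (F - G) ∈ monomialIdeal k S := by
    rw [mul_sub, ← Ideal.Quotient.eq, map_mul, map_mul]
    exact hFG
  rw [mem_monomialIdeal_iff_mem_restrictSupport hS (add_comm 1 j ▸ hL.mul hhom)] at hmem
  rw [sub_eq_zero.1 (of_not_not fun hne => hinj _ hhom hne hmem)]

theorem finrank_gradedPiece_le_succ {S : Finset (Fin (n + 1) →₀ ℕ)} {j : ℕ}
    (hS : ∀ a ∈ S, a.degree = j + 1) (hcard : S.card ≤ (n + j).choose (j + 1)) :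
    Module.finrank k (gradedPiece (monomialIdeal k S) j) ≤
      Module.finrank k (gradedPiece (monomialIdeal k S) (j + 1)) := by
  have hsource : Module.finrank k (gradedPiece (monomialIdeal k S) j) ≤ (n + j).choose j :=
    (Submodule.finrank_map_le _ _).trans_eq (finrank_homogeneousSubmodule j)
  have htarget := finrank_gradedPiece_add_card (k := k) hS
  have hpascal : (n + (j + 1)).choose (j + 1) = (n + j).choose j + (n + j).choose (j + 1) :=
    Nat.choose_succ_succ _ _
  omega

theorem injOn_of_hasMaximalRank {I : Ideal (MvPolynomial (Fin (n + 1)) k)} {j : ℕ}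
    {L : MvPolynomial (Fin (n + 1)) k}
    (hle : Module.finrank k (gradedPiece I j) ≤ Module.finrank k (gradedPiece I (j + 1)))
    (h : HasMaximalRank I j L) :
    Set.InjOn (fun u => Ideal.Quotient.mk I L * u) (gradedPiece I j : Set _) := by
  refine h.elim id fun hsurj => ?_
  let μ := (LinearMap.mulLeft k (Ideal.Quotient.mk I L)).domRestrict (gradedPiece I j)
  have hrange : gradedPiece I (j + 1) ≤ LinearMap.range μ := fun u hu => by
    obtain ⟨v, hv, rfl⟩ := hsurj hu
    exact ⟨⟨v, hv⟩, rfl⟩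
  have hrank := μ.finrank_range_add_finrank_ker
  have hker : LinearMap.ker μ = ⊥ := by
    rw [← Submodule.finrank_eq_zero (R := k)]
    have := Submodule.finrank_mono hrange
    omega
  intro u hu v hv huv
  exact congrArg Subtype.val (LinearMap.ker_eq_bot.1 hker (a₁ := ⟨u, hu⟩) (a₂ := ⟨v, hv⟩) huv)

theorem failsWLP_of_exists_restrictSupport {S : Finset (Fin (n + 1) →₀ ℕ)} {j : ℕ}
    (hS : ∀ a ∈ S, a.degree = j + 1) (hcard : S.card ≤ (n + j).choose (j + 1))
    (h : ∀ L : MvPolynomial (Fin (n + 1)) k, L.IsHomogeneous 1 →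
      ∃ F : MvPolynomial (Fin (n + 1)) k, F.IsHomogeneous j ∧ F ≠ 0 ∧
        L * F ∈ restrictSupport k (S : Set (Fin (n + 1) →₀ ℕ))) :
    FailsWLP (monomialIdeal k S) j := by
  intro L hL hmax
  obtain ⟨F, hF, hF0, hLF⟩ := h L hL
  rw [← mem_monomialIdeal_iff_mem_restrictSupport hS (add_comm 1 j ▸ hL.mul hF)] at hLF
  have hzero : Ideal.Quotient.mk (monomialIdeal k S) L * Ideal.Quotient.mk _ F = 0 := by
    rw [← map_mul]
    exact Ideal.Quotient.eq_zero_iff_mem.2 hLF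
  have hinj := injOn_of_hasMaximalRank (finrank_gradedPiece_le_succ hS hcard) hmax
  have hF0' : Ideal.Quotient.mk (monomialIdeal k S) F = 0 :=
    hinj ⟨F, hF, rfl⟩ (zero_mem _) (hzero.trans (mul_zero _).symm)
  exact hF0 (eq_zero_of_mem_monomialIdeal hS j.lt_succ_self hF
    (Ideal.Quotient.eq_zero_iff_mem.1 hF0'))

theorem homogeneousComponent_mul_of_isHomogeneous {σ : Type*} {L : MvPolynomial σ k} {i : ℕ}
    (hL : L.IsHomogeneous i) (F : MvPolynomial σ k) (j : ℕ) :
    homogeneousComponent (i + j) (L * F) = L * homogeneousComponent j F := by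
  let _ : GradedAlgebra (homogeneousSubmodule σ k) := gradedAlgebra
  rw [← decomposition.decompose'_apply, ← decomposition.decompose'_apply]
  exact DirectSum.coe_decompose_mul_add_of_left_mem (homogeneousSubmodule σ k) hL

/-- The last hypothesis says that the monomials of `S` become linearly dependent on every
hyperplane `L = 0`. -/
theorem isTogliatti_monomialIdeal {S : Finset (Fin (n + 1) →₀ ℕ)} {d : ℕ} (hn : 0 < n)
    (hd : 0 < d) (hS : ∀ a ∈ S, a.degree = d) (hcard : S.card ≤ (n + d - 1).choose (n - 1))
    (hpure : ∀ i, Finsupp.single i d ∈ S)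
    (h : ∀ L : MvPolynomial (Fin (n + 1)) k, L.IsHomogeneous 1 → L ≠ 0 →
      ∃ G ∈ restrictSupport k (S : Set (Fin (n + 1) →₀ ℕ)), G ≠ 0 ∧ L ∣ G) :
    IsTogliatti d (monomialIdeal k S) := by
  obtain ⟨j, rfl⟩ := Nat.exists_eq_add_one_of_ne_zero hd.ne'
  refine ⟨⟨S.card, fun i => monomial (S.equivFin.symm i).1 1, hcard,
    fun i => isHomogeneous_monomial _ (hS _ (S.equivFin.symm i).2), ?_⟩,
    isArtinianRing_quotient_of_single_mem hpure, ?_⟩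
  · change _ = Ideal.span
      (Set.range ((fun a => monomial a (1 : k)) ∘ Subtype.val ∘ S.equivFin.symm))
    rw [Set.range_comp, S.equivFin.symm.surjective.range_comp, Subtype.range_coe]
    rfl
  · refine failsWLP_of_exists_restrictSupport hS ?_ fun L hL => ?_
    · rwa [Nat.add_sub_cancel, ← Nat.choose_symm_of_eq_add (show n + j = n - 1 + (j + 1) by omega)]
    rcases eq_or_ne L 0 with rfl | hL0
    · exact ⟨X 0 ^ j, isHomogeneous_X_pow 0 j, pow_ne_zero _ (X_ne_zero 0), by simp⟩
    obtain ⟨_, hGS, hG0, F, rfl⟩ := h L hL hL0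
    have hLF : L * F = L * homogeneousComponent j F := by
      rw [← homogeneousComponent_mul_of_isHomogeneous hL, add_comm 1 j,
        homogeneousComponent_eq_self (isHomogeneous_of_mem_restrictSupport hS hGS)]
    rw [hLF] at hGS hG0
    exact ⟨_, homogeneousComponent_isHomogeneous j F, right_ne_zero_of_mul hG0, hGS⟩

/-! ### Restriction to a line -/

/-- The exponents of the pure powers `x_i^d`. -/
def pureExponents (n d : ℕ) : Finset (Fin (n + 1) →₀ ℕ) :=
  Finset.univ.image fun i => Finsupp.single i d

theorem mem_pureExponents {d : ℕ} {a : Fin (n + 1) →₀ ℕ} :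
    a ∈ pureExponents n d ↔ ∃ i, Finsupp.single i d = a := by
  simp only [pureExponents, Finset.mem_image, Finset.mem_univ, true_and]

theorem card_pureExponents {d : ℕ} (hd : d ≠ 0) : (pureExponents n d).card = n + 1 := by
  rw [pureExponents, Finset.card_image_of_injective _ (Finsupp.single_left_injective hd),
    Finset.card_univ, Fintype.card_fin]

theorem degree_of_mem_pureExponents {d : ℕ} {a : Fin (n + 1) →₀ ℕ} (ha : a ∈ pureExponents n d) :
    a.degree = d := by
  obtain ⟨i, rfl⟩ := mem_pureExponents.1 ha
  exact Finsupp.degree_single i d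

theorem pureExponents_subset_of_isTogliatti {S : Finset (Fin (n + 1) →₀ ℕ)} {d : ℕ}
    (hS : ∀ a ∈ S, a.degree = d) (h : IsTogliatti d (monomialIdeal k S)) :
    pureExponents n d ⊆ S := by
  intro a ha
  obtain ⟨i, rfl⟩ := mem_pureExponents.1 ha
  exact single_mem_of_isArtinianRing_quotient hS h.2.1 i

theorem numGens_le_of_isTogliatti {d : ℕ} {I : Ideal (MvPolynomial (Fin (n + 1)) k)}
    (h : IsTogliatti d I) : numGens I ≤ (n + d - 1).choose (n - 1) := by
  obtain ⟨⟨r, F, hr, -, rfl⟩, -, -⟩ := h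
  calc numGens (Ideal.span (Set.range F)) ≤ (Set.range F).ncard :=
        Submodule.spanFinrank_span_le_ncard_of_finite (Set.finite_range F)
    _ ≤ (Set.univ : Set (Fin r)).ncard := Set.image_univ (f := F) ▸ Set.ncard_image_le
    _ = r := by simp [Set.ncard_univ]
    _ ≤ _ := hr

theorem degree_eq_add_add (a : Fin (2 + 1) →₀ ℕ) : a.degree = a 0 + a 1 + a 2 := by
  rw [Finsupp.degree_eq_sum]
  exact Fin.sum_univ_three a

section Plane

variable (k) in
/-- Restriction of ternary forms to the line `x_0 + x_1 + x_2 = 0` of the projective plane,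
dehomogenised: `x_{σ 0} ↦ t`, `x_{σ 1} ↦ 1`, `x_{σ 2} ↦ -(1 + t)`. The permutation makes room for
`t`-adic arguments in each of the variables. -/
def lineRestriction (σ : Equiv.Perm (Fin (2 + 1))) :
    MvPolynomial (Fin (2 + 1)) k →ₐ[k] Polynomial k :=
  aeval (![Polynomial.X, 1, -(1 + Polynomial.X)] ∘ σ.symm)

theorem lineRestriction_sum_X (σ : Equiv.Perm (Fin (2 + 1))) :
    lineRestriction k σ (∑ i, X i) = 0 := by
  rw [lineRestriction, map_sum, ← Equiv.sum_comp σ]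
  simp only [aeval_X, Function.comp_apply, Equiv.symm_apply_apply]
  exact (Fin.sum_univ_three _).trans (add_neg_eq_zero.2 (add_comm _ _))

theorem lineRestriction_eq_sum (σ : Equiv.Perm (Fin (2 + 1))) {S : Finset (Fin (2 + 1) →₀ ℕ)}
    {G : MvPolynomial (Fin (2 + 1)) k} (hG : G ∈ restrictSupport k (S : Set _)) :
    lineRestriction k σ G = ∑ a ∈ S, Polynomial.C (coeff a G) *
      (Polynomial.X ^ a (σ 0) * (-(1 + Polynomial.X)) ^ a (σ 2)) := by
  rw [lineRestriction, aeval_def, eval₂_eq']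
  refine (Finset.sum_subset ((mem_restrictSupport_iff k).1 hG) fun a _ ha => ?_).trans
    (Finset.sum_congr rfl fun a _ => ?_)
  · rw [notMem_support_iff.1 ha, map_zero, zero_mul]
  · rw [← Equiv.prod_comp σ]
    simp only [Function.comp_apply, Equiv.symm_apply_apply]
    refine congrArg _ ((Fin.prod_univ_three _).trans ?_)
    simp

theorem coeff_lineRestriction (σ : Equiv.Perm (Fin (2 + 1)))
    (G : MvPolynomial (Fin (2 + 1)) k) (j : ℕ) :
    (lineRestriction k σ G).coeff j = ∑ a ∈ G.support, coeff a G *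
      if a (σ 0) ≤ j then (-1) ^ a (σ 2) * ((a (σ 2)).choose (j - a (σ 0)) : k) else 0 := by
  rw [lineRestriction_eq_sum σ (S := G.support) ((mem_restrictSupport_iff k).2 subset_rfl),
    Polynomial.finsetSum_coeff]
  refine Finset.sum_congr rfl fun a _ => ?_
  rw [Polynomial.coeff_C_mul, Polynomial.coeff_X_pow_mul', neg_pow, ← map_one Polynomial.C,
    ← map_neg, ← map_pow, Polynomial.coeff_C_mul, map_one, Polynomial.coeff_one_add_X_pow]

variable {σ : Equiv.Perm (Fin (2 + 1))} {G : MvPolynomial (Fin (2 + 1)) k}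

theorem coeff_eq_zero_of_forall_lt (hG : lineRestriction k σ G = 0) {a : Fin (2 + 1) →₀ ℕ}
    (ha : ∀ b ∈ G.support, b ≠ a → a (σ 0) < b (σ 0)) : coeff a G = 0 := by
  have h := coeff_lineRestriction σ G (a (σ 0))
  rw [hG, Finset.sum_eq_single a (fun b hb hba => by rw [if_neg (ha b hb hba).not_ge, mul_zero])
    (fun h => by rw [notMem_support_iff.1 h, zero_mul])] at h
  simpa using h.symm

theorem coeff_pure_eq_zero [CharZero k] {d : ℕ} (hd : 1 < d) (hG : lineRestriction k σ G = 0)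
    (h : ∀ a ∈ G.support, a ≠ Finsupp.single (σ 1) d → a ≠ Finsupp.single (σ 2) d → 1 < a (σ 0)) :
    coeff (Finsupp.single (σ 1) d) G = 0 ∧ coeff (Finsupp.single (σ 2) d) G = 0 := by
  have h2 : coeff (Finsupp.single (σ 2) d) G = 0 := by
    have hlin := coeff_lineRestriction σ G 1
    rw [hG, Finset.sum_eq_single (Finsupp.single (σ 2) d)] at hlin
    · have hd0 : (d : k) ≠ 0 := Nat.cast_ne_zero.2 (by omega)
      simpa [hd0] using hlin.symm
    · intro a ha ha2
      rcases eq_or_ne a (Finsupp.single (σ 1) d) with rfl | ha1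
      · simp
      · rw [if_neg (h a ha ha1 ha2).not_ge, mul_zero]
    · intro h
      rw [notMem_support_iff.1 h, zero_mul]
  refine ⟨coeff_eq_zero_of_forall_lt hG fun a ha ha1 => ?_, h2⟩
  have ha2 : a ≠ Finsupp.single (σ 2) d := fun h => mem_support_iff.1 ha (h ▸ h2)
  simpa using (h a ha ha1 ha2).pos

theorem eq_zero_of_injOn (hG : lineRestriction k σ G = 0)
    (hinj : Set.InjOn (fun a : Fin (2 + 1) →₀ ℕ => a (σ 0)) G.support) : G = 0 := by
  by_contra hG0
  obtain ⟨a, ha, hmin⟩ :=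
    Finset.exists_min_image G.support (fun a => a (σ 0)) (support_nonempty.2 hG0)
  refine mem_support_iff.1 ha (coeff_eq_zero_of_forall_lt hG fun b hb hba => ?_)
  exact (hmin b hb).lt_of_ne fun h => hba (hinj hb ha h.symm)

theorem eq_zero_of_card_sdiff_pureExponents_le_one [CharZero k] {d : ℕ} (hd : 1 < d)
    (hG : lineRestriction k σ G = 0) (hdeg : G.IsHomogeneous d)
    (hcard : (G.support \ pureExponents 2 d).card ≤ 1)
    (h : ∀ a ∈ G.support \ pureExponents 2 d, 1 < a (σ 0)) : G = 0 := by
  have hpure {a : Fin (2 + 1) →₀ ℕ} (ha : a ∈ pureExponents 2 d) : a = Finsupp.single (σ 0) d ∨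
      a = Finsupp.single (σ 1) d ∨ a = Finsupp.single (σ 2) d := by
    obtain ⟨j, rfl⟩ := mem_pureExponents.1 ha
    obtain ⟨l, rfl⟩ := σ.surjective j
    fin_cases l <;> simp
  obtain ⟨h1, h2⟩ := coeff_pure_eq_zero hd hG fun a ha ha1 ha2 => by
    by_cases hap : a ∈ pureExponents 2 d
    · rwa [(hpure hap).resolve_right (by tauto), Finsupp.single_eq_same]
    · exact h a (Finset.mem_sdiff.2 ⟨ha, hap⟩)
  have heq {a : Fin (2 + 1) →₀ ℕ} (ha : a ∈ G.support) (hap : a ∈ pureExponents 2 d) :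
      a = Finsupp.single (σ 0) d := by
    rcases hpure hap with h | rfl | rfl
    exacts [h, absurd h1 (mem_support_iff.1 ha), absurd h2 (mem_support_iff.1 ha)]
  have hsingle {b : Fin (2 + 1) →₀ ℕ} (hb : b ∈ G.support) (hbd : d = b (σ 0)) :
      Finsupp.single (σ 0) d = b :=
    eq_of_le_of_degree_eq (Finsupp.single_le_iff.2 hbd.le)
      ((Finsupp.degree_single _ _).trans (degree_eq_of_mem_support hdeg hb).symm)
  refine eq_zero_of_injOn hG fun a ha b hb (hab : a (σ 0) = b (σ 0)) => ?_
  by_cases hap : a ∈ pureExponents 2 d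
  · rw [heq ha hap, Finsupp.single_eq_same] at hab
    rw [heq ha hap, hsingle hb hab]
  by_cases hbp : b ∈ pureExponents 2 d
  · rw [heq hb hbp, Finsupp.single_eq_same] at hab
    rw [heq hb hbp, hsingle ha hab.symm]
  exact Finset.card_le_one.1 hcard a (Finset.mem_sdiff.2 ⟨ha, hap⟩) b (Finset.mem_sdiff.2 ⟨hb, hbp⟩)

end Plane

theorem exists_relation_of_isTogliatti {S : Finset (Fin (2 + 1) →₀ ℕ)} {d : ℕ} (hd : 0 < d)
    (hS : ∀ a ∈ S, a.degree = d) (h : IsTogliatti d (monomialIdeal k S)) :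
    ∃ G ∈ restrictSupport k (S : Set (Fin (2 + 1) →₀ ℕ)), G ≠ 0 ∧
      ∀ σ, lineRestriction k σ G = 0 := by
  have hL : (∑ i, X i : MvPolynomial (Fin (2 + 1)) k).IsHomogeneous 1 :=
    IsHomogeneous.sum _ _ _ fun i _ => isHomogeneous_X k i
  have hL0 : (∑ i, X i : MvPolynomial (Fin (2 + 1)) k) ≠ 0 := fun h0 => by
    simpa using congrArg (eval (Pi.single (0 : Fin (2 + 1)) (1 : k))) h0
  obtain ⟨F, -, hF0, hF⟩ := exists_restrictSupport_of_failsWLP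
    (fun a ha => (hS a ha).trans (Nat.sub_add_cancel hd).symm) h.2.2 hL
  exact ⟨_, hF, mul_ne_zero hL0 hF0, fun σ => by rw [map_mul, lineRestriction_sum_X, zero_mul]⟩

theorem exists_two_le_of_subsingleton {T : Finset (Fin (2 + 1) →₀ ℕ)} (hT : T.card ≤ 1)
    (hdeg : ∀ a ∈ T, 4 ≤ a.degree) : ∃ i, ∀ a ∈ T, 1 < a i := by
  by_contra! h
  obtain ⟨a, ha, -⟩ := h 0
  have hle : ∀ i, a i ≤ 1 := fun i => by
    obtain ⟨b, hb, hbi⟩ := h i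
    rwa [Finset.card_le_one.1 hT a ha b hb]
  have := hdeg a ha
  have := degree_eq_add_add a
  have := hle 0
  have := hle 1
  have := hle 2
  omega

/-- If `x^a` is the only generator other than pure powers, choose coordinates with `1 < a (σ 0)`:
the terms of a relation then vanish one after the other, in the order of their `t`-adic orders. -/
theorem five_le_card_of_isTogliatti [CharZero k] {d : ℕ} (hd : 4 ≤ d)
    {S : Finset (Fin (2 + 1) →₀ ℕ)} (hS : ∀ a ∈ S, a.degree = d)
    (h : IsTogliatti d (monomialIdeal k S)) : 5 ≤ S.card := by
  by_contra! hlt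
  obtain ⟨G, hGS, hG0, hG⟩ := exists_relation_of_isTogliatti (by omega) hS h
  have hsub : G.support \ pureExponents 2 d ⊆ S \ pureExponents 2 d :=
    Finset.sdiff_subset_sdiff ((mem_restrictSupport_iff k).1 hGS) le_rfl
  have hcard : (S \ pureExponents 2 d).card ≤ 1 := by
    rw [Finset.card_sdiff_of_subset (pureExponents_subset_of_isTogliatti hS h),
      card_pureExponents (by omega)]
    omega
  obtain ⟨i, hi⟩ := exists_two_le_of_subsingleton hcard fun a ha =>
    hd.trans_eq (hS a (Finset.mem_sdiff.1 ha).1).symm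
  refine hG0 (eq_zero_of_card_sdiff_pureExponents_le_one (by omega) (hG (Equiv.swap 0 i))
    (isHomogeneous_of_mem_restrictSupport hS hGS) ((Finset.card_le_card hsub).trans hcard)
    fun a ha => ?_)
  rw [Equiv.swap_apply_left]
  exact hi a (hsub ha)

/-! ### Ternary monomials -/

/-- The exponent of the ternary monomial `x_0^a x_1^b x_2^c`. -/
def expo (a b c : ℕ) : Fin (2 + 1) →₀ ℕ :=
  Finsupp.equivFunOnFinite.symm ![a, b, c]

@[simp]
theorem expo_apply_zero (a b c : ℕ) : expo a b c 0 = a := rfl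

@[simp]
theorem expo_apply_one (a b c : ℕ) : expo a b c 1 = b := rfl

@[simp]
theorem expo_apply_two (a b c : ℕ) : expo a b c 2 = c := rfl

@[simp]
theorem degree_expo (a b c : ℕ) : (expo a b c).degree = a + b + c :=
  degree_eq_add_add _

theorem expo_inj {a b c a' b' c' : ℕ} :
    expo a b c = expo a' b' c' ↔ a = a' ∧ b = b' ∧ c = c' := by
  refine ⟨fun h => ⟨?_, ?_, ?_⟩, by rintro ⟨rfl, rfl, rfl⟩; rfl⟩
  exacts [DFunLike.congr_fun h 0, DFunLike.congr_fun h 1, DFunLike.congr_fun h 2]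

theorem monomial_expo (a b c : ℕ) :
    monomial (expo a b c) (1 : k) = X 0 ^ a * X 1 ^ b * X 2 ^ c := by
  rw [monomial_eq, map_one, one_mul, Finsupp.prod_fintype _ _ fun i => pow_zero _]
  exact Fin.prod_univ_three _

theorem exists_eq_of_isHomogeneous_one {L : MvPolynomial (Fin (2 + 1)) k}
    (hL : L.IsHomogeneous 1) : ∃ a b c : k, L = C a * X 0 + C b * X 1 + C c * X 2 := by
  rw [← mem_homogeneousSubmodule, homogeneousSubmodule_one_eq_span_X,
    Submodule.mem_span_range_iff_exists_fun] at hL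
  obtain ⟨c, rfl⟩ := hL
  simp only [smul_eq_C_mul]
  exact ⟨c 0, c 1, c 2, Fin.sum_univ_three _⟩

theorem C_mul_monomial_mem_restrictSupport {σ : Type*} {S : Set (σ →₀ ℕ)} {a : σ →₀ ℕ}
    (ha : a ∈ S) (c : k) : C c * monomial a 1 ∈ restrictSupport k S := by
  rw [C_mul_monomial, monomial_mem_restrictSupport]
  exact Or.inl ha

/-! ### The corner system -/

/-- The exponents of the generators of `I_5`, where `d` is the degree. -/
def cornerExponents (d : ℕ) : Finset (Fin (2 + 1) →₀ ℕ) :=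
  pureExponents 2 d ∪ {expo (d - 1) 1 0, expo (d - 1) 0 1}

theorem degree_of_mem_cornerExponents {d : ℕ} (hd : 0 < d) {a : Fin (2 + 1) →₀ ℕ}
    (ha : a ∈ cornerExponents d) : a.degree = d := by
  simp only [cornerExponents, Finset.mem_union, Finset.mem_insert, Finset.mem_singleton] at ha
  rcases ha with ha | rfl | rfl
  · exact degree_of_mem_pureExponents ha
  all_goals rw [degree_expo]; omega

theorem ne_of_mem_pureExponents {d : ℕ} {a b : Fin (2 + 1) →₀ ℕ} (ha : a ∈ pureExponents 2 d)
    {i j : Fin (2 + 1)} (hij : i ≠ j) (hi : b i ≠ 0) (hj : b j ≠ 0) : b ≠ a := by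
  obtain ⟨l, rfl⟩ := mem_pureExponents.1 ha
  rintro rfl
  exact hij ((Finsupp.single_apply_ne_zero.1 hi).1.trans (Finsupp.single_apply_ne_zero.1 hj).1.symm)

theorem card_cornerExponents {d : ℕ} (hd : 1 < d) : (cornerExponents d).card = 5 := by
  rw [cornerExponents, Finset.card_union_of_disjoint, card_pureExponents (by omega),
    Finset.card_pair (by simp [expo_inj])]
  rw [Finset.disjoint_right]
  simp only [Finset.mem_insert, Finset.mem_singleton]
  rintro _ (rfl | rfl) ha
  · exact ne_of_mem_pureExponents ha (i := 0) (j := 1) (by decide) (by simp; omega) (by simp) rfl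
  · exact ne_of_mem_pureExponents ha (i := 0) (j := 2) (by decide) (by simp; omega) (by simp) rfl

theorem isTogliatti_cornerExponents {d : ℕ} (hd : 4 ≤ d) :
    IsTogliatti d (monomialIdeal k (cornerExponents d)) := by
  have hpure (i : Fin (2 + 1)) : Finsupp.single i d ∈ cornerExponents d :=
    Finset.mem_union_left _ (mem_pureExponents.2 ⟨i, rfl⟩)
  refine isTogliatti_monomialIdeal two_pos (by omega)
    (fun a ha => degree_of_mem_cornerExponents (by omega) ha) ?_ hpure fun L hL hL0 => ?_
  · rw [card_cornerExponents (by omega)]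
    norm_num
    omega
  obtain ⟨a, b, c, rfl⟩ := exists_eq_of_isHomogeneous_one hL
  refine ⟨_, ?_, mul_ne_zero hL0 (pow_ne_zero (d - 1) (X_ne_zero 0)), dvd_mul_right _ _⟩
  have h0 := C_mul_monomial_mem_restrictSupport (hpure 0) a
  have h1 : C b * monomial (expo (d - 1) 1 0) 1 ∈ restrictSupport k (cornerExponents d : Set _) :=
    C_mul_monomial_mem_restrictSupport (by simp [cornerExponents]) b
  have h2 : C c * monomial (expo (d - 1) 0 1) 1 ∈ restrictSupport k (cornerExponents d : Set _) :=
    C_mul_monomial_mem_restrictSupport (by simp [cornerExponents]) c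
  convert add_mem (add_mem h0 h1) h2 using 1
  rw [← X_pow_eq_monomial, monomial_expo, monomial_expo, ← mul_pow_sub_one (by omega : d ≠ 0)]
  ring

theorem isMinimalMonomialTogliatti_cornerExponents [CharZero k] {d : ℕ} (hd : 4 ≤ d) :
    IsMinimalMonomialTogliatti d (monomialIdeal k (cornerExponents d)) := by
  have hdeg := fun a => degree_of_mem_cornerExponents (a := a) (by omega : 0 < d)
  refine ⟨_, hdeg, rfl, isTogliatti_cornerExponents hd, fun T hT hTog => ?_⟩
  have h5 := five_le_card_of_isTogliatti hd (fun a ha => hdeg a (hT.1 ha)) hTog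
  exact (h5.trans_lt (Finset.card_lt_card hT)).ne (card_cornerExponents (by omega)).symm

/-! ### The strip systems -/

/-- The exponents of the generators of `I_r` other than the pure powers, where `r = m + 5` and the
degree is `d = e + m + 2`. -/
def innerExponents (e m : ℕ) : Finset (Fin (2 + 1) →₀ ℕ) :=
  insert (expo e 1 (m + 1))
    ((antidiagonal m).image fun ij => expo (e + ij.1) (ij.2 + 1) 1)

/-- The exponents of the generators of `I_r`, where `r = m + 5` and the degree is
`d = e + m + 2`. -/
def stripExponents (e m : ℕ) : Finset (Fin (2 + 1) →₀ ℕ) :=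
  pureExponents 2 (e + m + 2) ∪ innerExponents e m

theorem mem_innerExponents {e m : ℕ} {a : Fin (2 + 1) →₀ ℕ} :
    a ∈ innerExponents e m ↔
      a = expo e 1 (m + 1) ∨ ∃ i j, i + j = m ∧ expo (e + i) (j + 1) 1 = a := by
  simp [innerExponents]

theorem sum_innerExponents {M : Type*} [AddCommMonoid M] {e m : ℕ} (hm : 0 < m)
    (f : (Fin (2 + 1) →₀ ℕ) → M) :
    ∑ a ∈ innerExponents e m, f a = f (expo e 1 (m + 1)) +
      ∑ ij ∈ antidiagonal m, f (expo (e + ij.1) (ij.2 + 1) 1) := by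
  rw [innerExponents, Finset.sum_insert, Finset.sum_image]
  · rintro ⟨i, j⟩ - ⟨i', j'⟩ - hij
    simp only [expo_inj] at hij
    rw [Prod.mk.injEq]
    omega
  · simp only [Finset.mem_image, expo_inj, not_exists, not_and]
    omega

theorem le_of_mem_innerExponents {e m : ℕ} {a : Fin (2 + 1) →₀ ℕ} (ha : a ∈ innerExponents e m) :
    e ≤ a 0 ∧ 0 < a 1 ∧ 0 < a 2 := by
  rcases mem_innerExponents.1 ha with rfl | ⟨i, j, -, rfl⟩ <;> simp

theorem disjoint_pureExponents_innerExponents (d e m : ℕ) :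
    Disjoint (pureExponents 2 d) (innerExponents e m) :=
  Finset.disjoint_left.2 fun _ hp ha =>
    ne_of_mem_pureExponents hp (i := 1) (j := 2) (by decide) (le_of_mem_innerExponents ha).2.1.ne'
      (le_of_mem_innerExponents ha).2.2.ne' rfl

theorem degree_of_mem_stripExponents {e m : ℕ} {a : Fin (2 + 1) →₀ ℕ}
    (ha : a ∈ stripExponents e m) : a.degree = e + m + 2 := by
  rw [stripExponents, Finset.mem_union, mem_innerExponents] at ha
  rcases ha with h | rfl | ⟨i, j, hij, rfl⟩
  · exact degree_of_mem_pureExponents h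
  all_goals rw [degree_expo]; omega

theorem card_stripExponents {e m : ℕ} (hm : 0 < m) : (stripExponents e m).card = m + 5 := by
  rw [stripExponents, Finset.card_union_of_disjoint (disjoint_pureExponents_innerExponents _ _ _),
    card_pureExponents (by omega), Finset.card_eq_sum_ones, sum_innerExponents hm,
    ← Finset.card_eq_sum_ones, Finset.Nat.card_antidiagonal]
  omega

theorem mul_sub_pow_mem_restrictSupport (e m : ℕ) (a b c : k) :
    X 0 ^ e * X 1 * X 2 * ((C c * X 2) ^ m - (C a * X 0 + C b * X 1) ^ m) ∈
      restrictSupport k (innerExponents e m : Set (Fin (2 + 1) →₀ ℕ)) := by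
  rw [mul_sub, (Commute.all _ _).add_pow', Finset.mul_sum]
  refine sub_mem ?_ (sum_mem fun ij hij => ?_)
  · convert C_mul_monomial_mem_restrictSupport
      (mem_innerExponents.2 (Or.inl rfl) : expo e 1 (m + 1) ∈ innerExponents e m) (c ^ m) using 1
    rw [monomial_expo, C_pow]
    ring
  · convert C_mul_monomial_mem_restrictSupport (mem_innerExponents.2
      (Or.inr ⟨ij.1, ij.2, mem_antidiagonal.1 hij, rfl⟩) :
        expo (e + ij.1) (ij.2 + 1) 1 ∈ innerExponents e m)
      (m.choose ij.1 * a ^ ij.1 * b ^ ij.2) using 1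
    rw [monomial_expo, nsmul_eq_mul]
    simp only [map_mul, map_natCast, C_pow]
    ring

theorem isTogliatti_stripExponents {e m : ℕ} (hm : 0 < m) (he : 2 ≤ e) :
    IsTogliatti (e + m + 2) (monomialIdeal k (stripExponents e m)) := by
  refine isTogliatti_monomialIdeal two_pos (by omega) (fun a => degree_of_mem_stripExponents) ?_
    (fun i => Finset.mem_union_left _ (mem_pureExponents.2 ⟨i, rfl⟩)) fun L hL hL0 => ?_
  · rw [card_stripExponents hm]
    norm_num
    omega
  obtain ⟨a, b, c, rfl⟩ := exists_eq_of_isHomogeneous_one hL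
  refine ⟨_, restrictSupport_mono k (Finset.coe_subset.2 Finset.subset_union_right)
    (mul_sub_pow_mem_restrictSupport e m (-a) (-b) c), ?_, Dvd.dvd.mul_left ?_ _⟩
  · refine mul_ne_zero (mul_ne_zero (mul_ne_zero (pow_ne_zero _ (X_ne_zero _)) (X_ne_zero _))
      (X_ne_zero _)) fun h0 => hL0 ?_
    have hev (x : Fin (2 + 1) → k) := congrArg (eval x) h0
    have ha : a = 0 := by simpa [hm.ne'] using hev ![1, 0, 0]
    have hb : b = 0 := by simpa [hm.ne'] using hev ![0, 1, 0]
    have hc : c = 0 := by simpa [hm.ne'] using hev ![0, 0, 1]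
    simp [ha, hb, hc]
  · refine dvd_trans (Eq.dvd ?_) (sub_dvd_pow_sub_pow _ _ m)
    rw [C_neg, C_neg]
    ring

section Minimality

variable {e m : ℕ} {G : MvPolynomial (Fin (2 + 1)) k}

theorem mem_restrictSupport_innerExponents [CharZero k] (he : 2 ≤ e)
    (hGS : G ∈ restrictSupport k (stripExponents e m : Set (Fin (2 + 1) →₀ ℕ)))
    (hG : ∀ σ, lineRestriction k σ G = 0) :
    G ∈ restrictSupport k (innerExponents e m : Set (Fin (2 + 1) →₀ ℕ)) := by
  rw [mem_restrictSupport_iff] at hGS ⊢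
  have hcases {a : Fin (2 + 1) →₀ ℕ} (ha : a ∈ G.support) : a ∈ innerExponents e m ∨
      a = Finsupp.single 0 (e + m + 2) ∨ a = Finsupp.single 1 (e + m + 2) ∨
        a = Finsupp.single 2 (e + m + 2) := by
    rcases Finset.mem_union.1 (hGS ha) with h | h
    · obtain ⟨i, rfl⟩ := mem_pureExponents.1 h
      fin_cases i <;> simp
    · exact Or.inl h
  obtain ⟨h1, h2⟩ := coeff_pure_eq_zero (by omega : 1 < e + m + 2) (hG 1) fun a ha ha1 ha2 => by
    rcases hcases ha with h | rfl | h | h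
    · exact he.trans (le_of_mem_innerExponents h).1
    · simp
    exacts [absurd h ha1, absurd h ha2]
  have h0 : coeff (Finsupp.single 0 (e + m + 2)) G = 0 := by
    refine coeff_eq_zero_of_forall_lt (hG (Equiv.swap 0 2)) fun b hb hb0 => ?_
    rcases hcases hb with h | h | rfl | rfl
    · simpa using (le_of_mem_innerExponents h).2.2
    exacts [absurd h hb0, absurd h1 (mem_support_iff.1 hb), absurd h2 (mem_support_iff.1 hb)]
  intro a ha
  rcases hcases ha with h | rfl | rfl | rfl
  exacts [h, absurd h0 (mem_support_iff.1 ha), absurd h1 (mem_support_iff.1 ha),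
    absurd h2 (mem_support_iff.1 ha)]

/-- Dividing the restriction of `G` by `-(1 + t) t^e` leaves a combination of `1, t, …, t^m` and
`(1 + t)^m`. -/
theorem coeff_expo_of_lineRestriction_eq_zero (hm : 0 < m)
    (hGS : G ∈ restrictSupport k (innerExponents e m : Set (Fin (2 + 1) →₀ ℕ)))
    (hG : lineRestriction k 1 G = 0) {i j : ℕ} (hij : i + j = m) :
    coeff (expo (e + i) (j + 1) 1) G = -((-1) ^ m * m.choose i) * coeff (expo e 1 (m + 1)) G := by
  let P : Polynomial k := Polynomial.C (coeff (expo e 1 (m + 1)) G) * (-(1 + Polynomial.X)) ^ m +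
    ∑ ij ∈ antidiagonal m,
      Polynomial.C (coeff (expo (e + ij.1) (ij.2 + 1) 1) G) * Polynomial.X ^ ij.1
  have hfactor : lineRestriction k 1 G = Polynomial.X ^ e * (-(1 + Polynomial.X)) * P := by
    rw [lineRestriction_eq_sum 1 hGS, sum_innerExponents hm, mul_add, Finset.mul_sum]
    simp only [Equiv.Perm.one_apply, expo_apply_zero, expo_apply_two]
    exact congrArg₂ (· + ·) (by ring) (Finset.sum_congr rfl fun _ _ => by ring)
  have hX : -(1 + Polynomial.X : Polynomial k) ≠ 0 :=
    neg_ne_zero.2 (add_comm (1 : Polynomial k) _ ▸ Polynomial.X_add_C_ne_zero 1)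
  have hP : P = 0 := (mul_eq_zero.1 (hfactor.symm.trans hG)).resolve_left
    (mul_ne_zero (pow_ne_zero _ Polynomial.X_ne_zero) hX)
  have hcoeff : P.coeff i = coeff (expo e 1 (m + 1)) G * ((-1) ^ m * m.choose i) +
      coeff (expo (e + i) (j + 1) 1) G := by
    rw [Polynomial.coeff_add, Polynomial.coeff_C_mul, neg_pow, ← map_one Polynomial.C, ← map_neg,
      ← map_pow, Polynomial.coeff_C_mul, map_one, Polynomial.coeff_one_add_X_pow,
      Polynomial.finsetSum_coeff, Finset.sum_eq_single (i, j)]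
    · simp
    · rintro ⟨i', j'⟩ hij' hne
      rw [mem_antidiagonal] at hij'
      have : i ≠ i' := by
        rintro rfl
        exact hne (by rw [Prod.mk.injEq]; omega)
      simp [Polynomial.coeff_X_pow, this]
    · exact fun h => absurd (mem_antidiagonal.2 hij) h
  rw [hP, Polynomial.coeff_zero] at hcoeff
  linear_combination -hcoeff

theorem eq_zero_of_coeff_innerExponents_eq_zero [CharZero k] (hm : 0 < m)
    (hGS : G ∈ restrictSupport k (innerExponents e m : Set (Fin (2 + 1) →₀ ℕ)))
    (hG : lineRestriction k 1 G = 0) {a : Fin (2 + 1) →₀ ℕ} (ha : a ∈ innerExponents e m)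
    (haG : coeff a G = 0) : G = 0 := by
  have hcoeff := fun i j => coeff_expo_of_lineRestriction_eq_zero hm hGS hG (i := i) (j := j)
  have h0 : coeff (expo e 1 (m + 1)) G = 0 := by
    rcases mem_innerExponents.1 ha with rfl | ⟨i, j, hij, rfl⟩
    · exact haG
    · have hchoose : (m.choose i : k) ≠ 0 := Nat.cast_ne_zero.2 (Nat.choose_pos (by omega)).ne'
      simpa [haG, hchoose] using hcoeff i j hij
  refine support_eq_empty.1 (Finset.eq_empty_of_forall_notMem fun b hb => mem_support_iff.1 hb ?_)
  rcases mem_innerExponents.1 ((mem_restrictSupport_iff k).1 hGS hb) with rfl | ⟨i, j, hij, rfl⟩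
  · exact h0
  · rw [hcoeff i j hij, h0, mul_zero]

end Minimality

theorem isMinimalMonomialTogliatti_stripExponents [CharZero k] {e m : ℕ} (hm : 0 < m)
    (he : 2 ≤ e) :
    IsMinimalMonomialTogliatti (e + m + 2) (monomialIdeal k (stripExponents e m)) := by
  refine ⟨_, fun a => degree_of_mem_stripExponents, rfl, isTogliatti_stripExponents hm he,
    fun T hT hTog => ?_⟩
  have hdeg : ∀ a ∈ T, a.degree = e + m + 2 := fun a ha => degree_of_mem_stripExponents (hT.1 ha)
  obtain ⟨a, haS, haT⟩ := Finset.exists_of_ssubset hT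
  have ha : a ∈ innerExponents e m := (Finset.mem_union.1 haS).resolve_left fun h =>
    haT (pureExponents_subset_of_isTogliatti hdeg hTog h)
  obtain ⟨G, hGT, hG0, hG⟩ := exists_relation_of_isTogliatti (by omega) hdeg hTog
  have hGS := mem_restrictSupport_innerExponents he
    (restrictSupport_mono k (Finset.coe_subset.2 hT.1) hGT) hG
  refine hG0 (eq_zero_of_coeff_innerExponents_eq_zero hm hGS (hG 1) ha ?_)
  exact notMem_support_iff.1 fun h => haT ((mem_restrictSupport_iff k).1 hGT h)

/-! ### Generators of the explicit systems -/

theorem image_pureExponents (d : ℕ) :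
    (fun a => monomial a (1 : k)) '' (pureExponents 2 d : Set (Fin (2 + 1) →₀ ℕ)) =
      {X 0 ^ d, X 1 ^ d, X 2 ^ d} := by
  have huniv : Set.range (fun i : Fin (2 + 1) => i) = {0, 1, 2} := by
    ext i
    fin_cases i <;> simp
  rw [pureExponents, Finset.coe_image, Finset.coe_univ, ← Set.range_id', huniv, Set.image_image]
  simp only [Set.image_insert_eq, Set.image_singleton, X_pow_eq_monomial]

theorem explicitIdeal_five (d : ℕ) :
    explicitIdeal k d 5 = monomialIdeal k (cornerExponents d) := by
  rw [explicitIdeal, if_pos rfl, ← Ideal.span_union, monomialIdeal, cornerExponents,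
    Finset.coe_union, Set.image_union, image_pureExponents]
  simp only [Finset.coe_insert, Finset.coe_singleton, Set.image_insert_eq, Set.image_singleton,
    monomial_expo, pow_zero, pow_one, mul_one]

open scoped Pointwise in
theorem image_innerExponents (e m : ℕ) :
    (fun a => monomial a (1 : k)) '' (innerExponents e m : Set (Fin (2 + 1) →₀ ℕ)) =
      {X 0 ^ e * X 1 * X 2} *
        ({p | ∃ i j : ℕ, i + j = m ∧ p = X 0 ^ i * X 1 ^ j} ∪ {X 2 ^ m}) := by
  ext p
  simp only [Set.singleton_mul, Set.mem_image, Set.mem_union, Set.mem_ofPred_eq,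
    Set.mem_singleton_iff, Finset.mem_coe, mem_innerExponents]
  constructor
  · rintro ⟨_, rfl | ⟨i, j, hij, rfl⟩, rfl⟩
    · exact ⟨_, Or.inr rfl, by rw [monomial_expo]; ring⟩
    · exact ⟨_, Or.inl ⟨i, j, hij, rfl⟩, by rw [monomial_expo]; ring⟩
  · rintro ⟨_, ⟨i, j, hij, rfl⟩ | rfl, rfl⟩
    · exact ⟨_, Or.inr ⟨i, j, hij, rfl⟩, by rw [monomial_expo]; ring⟩
    · exact ⟨_, Or.inl rfl, by rw [monomial_expo]; ring⟩

theorem explicitIdeal_strip {e m : ℕ} (hm : 0 < m) :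
    explicitIdeal k (e + m + 2) (m + 5) = monomialIdeal k (stripExponents e m) := by
  rw [explicitIdeal, if_neg (by omega), Ideal.span_mul_span', ← Ideal.span_union, monomialIdeal,
    show e + m + 2 + 3 - (m + 5) = e by omega, Nat.add_sub_cancel, stripExponents,
    Finset.coe_union, Set.image_union, image_pureExponents, image_innerExponents]

/-! ### Points and tangent vectors of the cone -/

section MonomialHom

variable {α σ τ : Type*}

/-- The homomorphism of polynomial rings which substitutes the monomial `x^(e a)` for the `a`-th
variable. -/
def monomialHom (e : α → σ →₀ ℕ) : MvPolynomial α k →ₐ[k] MvPolynomial σ k :=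
  aeval fun a => monomial (e a) 1

/-- A monomial substitution depends only on the additive relations between its exponents, and
these can be tested in any commutative monoid into which the exponents embed. -/
theorem monomialHom_eq_zero_iff {M : Type*} [AddCommMonoid M] {T : (σ →₀ ℕ) →+ M}
    {T' : (τ →₀ ℕ) →+ M} (hT : Function.Injective T) (hT' : Function.Injective T')
    {e : α → σ →₀ ℕ} {e' : α → τ →₀ ℕ} (h : ∀ a, T (e a) = T' (e' a)) (f : MvPolynomial α k) :
    monomialHom e f = 0 ↔ monomialHom e' f = 0 := by
  have hcomp : (AddMonoidAlgebra.mapDomainAlgHom k k T).comp (monomialHom e) =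
      (AddMonoidAlgebra.mapDomainAlgHom k k T').comp (monomialHom e') := by
    refine algHom_ext fun a => ?_
    simp [monomialHom, monomial, h]
  have hf := DFunLike.congr_fun hcomp f
  rw [← map_eq_zero_iff (AddMonoidAlgebra.mapDomainAlgHom k k T)
      (AddMonoidAlgebra.mapDomain_injective hT),
    ← map_eq_zero_iff (AddMonoidAlgebra.mapDomainAlgHom k k T')
      (AddMonoidAlgebra.mapDomain_injective hT')]
  exact hf ▸ Iff.rfl

end MonomialHom

theorem mem_coneIdeal_iff [Infinite k] {A : Finset (Fin (n + 1) →₀ ℕ)} {f : MvPolynomial A k} :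
    f ∈ coneIdeal k A ↔ monomialHom (fun a : A => a.1) f = 0 := by
  have heval (x : Fin (n + 1) → k) :
      aeval (monomialMap A x) f = eval x (monomialHom (fun a : A => a.1) f) := by
    rw [monomialHom, ← aeval_eq_eval, ← AlgHom.comp_apply, comp_aeval]
    congr 2
    funext a
    rw [aeval_monomial, map_one, one_mul, Finsupp.prod_fintype _ _ fun i => pow_zero _, monomialMap]
  simp only [coneIdeal, mem_vanishingIdeal_iff, Set.forall_mem_range, heval]
  exact ⟨fun h => MvPolynomial.funext fun x => (h x).trans (map_zero _).symm,
    fun h x => by rw [h, map_zero]⟩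

section ConePoint

variable {A : Finset (Fin (n + 1) →₀ ℕ)} {R : Type*} [CommRing R] [Algebra k R]

variable (k) in
/-- The family `z` is an `R`-valued point of the affine cone over `X_A`. -/
def IsConePoint (A : Finset (Fin (n + 1) →₀ ℕ)) (z : A → R) : Prop :=
  ∀ f ∈ coneIdeal k A, aeval z f = 0

theorem fst_aeval_dualNumber (z : A → DualNumber k) (f : MvPolynomial A k) :
    (aeval z f).fst = eval (fun a => (z a).fst) f := by
  change TrivSqZeroExt.fstHom k k k (aeval z f) = _
  rw [← AlgHom.comp_apply, comp_aeval, aeval_eq_eval]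
  rfl

theorem snd_aeval_dualNumber (z : A → DualNumber k) (f : MvPolynomial A k) :
    (aeval z f).snd = ∑ a, eval (fun a => (z a).fst) (pderiv a f) * (z a).snd := by
  classical
  induction f using MvPolynomial.induction_on with
  | C c => simp [TrivSqZeroExt.algebraMap_eq_inl]
  | add p q hp hq => simp [hp, hq, add_mul, Finset.sum_add_distrib]
  | mul_X p a hp =>
    simp only [map_mul, aeval_X, DualNumber.snd_mul, fst_aeval_dualNumber, hp, pderiv_mul, map_add,
      add_mul, Finset.sum_add_distrib, pderiv_X, eval_X]
    rw [add_comm, Finset.sum_mul, Finset.sum_eq_single (a := a) (f := fun b => _ * eval _ _ * _)]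
    · simp [mul_right_comm]
    · intro b _ hb
      simp [Pi.single_eq_of_ne hb.symm]
    · simp

theorem isConePoint_dualNumber_iff {z : A → DualNumber k} :
    IsConePoint k A z ↔ (fun a => (z a).fst) ∈ zeroLocus k (coneIdeal k A) ∧
      (fun a => (z a).snd) ∈ tangentSpace A fun a => (z a).fst := by
  simp only [IsConePoint, TrivSqZeroExt.ext_iff, fst_aeval_dualNumber, snd_aeval_dualNumber,
    mem_zeroLocus_iff, aeval_eq_eval]
  exact forall₂_and

end ConePoint

/-! ### Monomial charts -/

/-- The exponents of a multigraded polynomial ring as integer vectors. -/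
def intVector {σ : Type*} : (σ →₀ ℕ) →+ (σ → ℤ) where
  toFun a i := a i
  map_zero' := by simp [funext_iff]
  map_add' := by simp [funext_iff]

theorem intVector_injective {σ : Type*} : Function.Injective (intVector (σ := σ)) := fun a b h => by
  ext i
  exact Nat.cast_injective (congrFun h i)

theorem linearIndependent_nat {ι M : Type*} [AddCommGroup M] {v : ι → M}
    (hv : LinearIndependent ℤ v) : LinearIndependent ℕ v :=
  hv.restrict_scalars fun a b h => Nat.cast_injective (R := ℤ) (by simpa using h)

/-- A monomial chart of the cone over `X_A`: if `Z_0, …, Z_n` are the coordinates belonging to the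
exponents `frame 0, …, frame n`, then every coordinate is the monomial
`Z_0 ∏ (Z_{j+1} / Z_0)^(coord a j)`, so that the open set `Z_0 ≠ 0` of the cone is smooth with
coordinates `Z_0, …, Z_n`. -/
structure Chart (A : Finset (Fin (n + 1) →₀ ℕ)) where
  frame : Fin (n + 1) → A
  coord : A → Fin n →₀ ℕ
  linearIndependent : LinearIndependent ℤ fun i => intVector (frame i).1
  rel : ∀ a, a.1 + (∑ j, coord a j) • (frame 0).1 =
    (frame 0).1 + ∑ j, coord a j • (frame j.succ).1

namespace Chart

variable {A : Finset (Fin (n + 1) →₀ ℕ)} (c : Chart A)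

/-- The embedding of the exponents of the parameters of a chart: the vertex `frame 0`, and the
directions from it to the other members of the frame. -/
def direction : (Fin (n + 1) →₀ ℕ) →+ (Fin (n + 1) → ℤ) :=
  (Finsupp.linearCombination ℕ ((fun i => intVector (c.frame i).1) +
    fun i => (Fin.cons 0 (-1) : Fin (n + 1) → ℤ) i • intVector (c.frame 0).1)).toAddMonoidHom

theorem direction_cons (s : ℕ) (p : Fin n →₀ ℕ) : c.direction (p.cons s) =
    s • intVector (c.frame 0).1 +
      ∑ j, p j • (intVector (c.frame j.succ).1 - intVector (c.frame 0).1) := by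
  rw [direction, LinearMap.toAddMonoidHom_coe, Finsupp.linearCombination_apply,
    Finsupp.sum_fintype _ _ (by simp), Fin.sum_univ_succ]
  simp [sub_eq_add_neg]

theorem direction_injective : Function.Injective c.direction :=
  linearIndependent_nat <|
    (linearIndependent_add_smul_iff (i := 0) rfl).2 c.linearIndependent

theorem intVector_eq_direction (a : A) : intVector a.1 = c.direction ((c.coord a).cons 1) := by
  have h := congrArg intVector (c.rel a)
  simp only [map_add, map_sum, map_nsmul] at h
  rw [direction_cons]
  simp only [smul_sub, Finset.sum_sub_distrib, ← Finset.sum_smul, one_smul]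
  rw [← add_sub_assoc, ← h, add_sub_cancel_right]

theorem coord_frame_zero : c.coord (c.frame 0) = 0 := by
  have h : c.direction ((c.coord (c.frame 0)).cons 1) = c.direction (Finsupp.cons 1 0) := by
    rw [← intVector_eq_direction, direction_cons]
    simp
  simpa using congrArg Finsupp.tail (c.direction_injective h)

theorem coord_frame_succ (j : Fin n) : c.coord (c.frame j.succ) = Finsupp.single j 1 := by
  have h : c.direction ((c.coord (c.frame j.succ)).cons 1) =
      c.direction ((Finsupp.single j 1).cons 1) := by
    rw [← intVector_eq_direction, direction_cons, Finset.sum_eq_single j]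
    · simp
    · intro i _ hi
      simp [hi.symm]
    · simp
  simpa using congrArg Finsupp.tail (c.direction_injective h)

section Points

variable {R : Type*} [CommRing R]

/-- The parametrization of the cone over `X_A` inverse to a chart, in the parameters `Z_0` and
`Z_{j+1} / Z_0`. -/
def param (t : Fin (n + 1) → R) : A → R :=
  fun a => t 0 * ∏ j, t j.succ ^ c.coord a j

theorem param_frame_zero (t : Fin (n + 1) → R) : c.param t (c.frame 0) = t 0 := by
  simp [param, coord_frame_zero]

theorem param_frame_succ (t : Fin (n + 1) → R) (j : Fin n) :
    c.param t (c.frame j.succ) = t 0 * t j.succ := by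
  rw [param, coord_frame_succ, Finset.prod_eq_single j]
  · simp
  · intro i _ hi
    simp [hi.symm]
  · simp

variable [Algebra k R] [Infinite k]

theorem isConePoint_param (t : Fin (n + 1) → R) : IsConePoint k A (c.param t) := by
  intro f hf
  have hf' : monomialHom (fun a => (c.coord a).cons 1) f = 0 :=
    (monomialHom_eq_zero_iff intVector_injective c.direction_injective
      c.intVector_eq_direction f).1 (mem_coneIdeal_iff.1 hf)
  have h := congrArg (aeval t) hf'
  rw [map_zero, monomialHom, ← AlgHom.comp_apply, comp_aeval] at h
  convert h using 3
  funext a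
  rw [aeval_monomial, map_one, one_mul, Finsupp.prod_fintype _ _ fun i => pow_zero _,
    Fin.prod_univ_succ]
  simp [param]

variable {c}

theorem mul_pow_eq_of_isConePoint {z : A → R} (hz : IsConePoint k A z) (a : A) :
    z a * z (c.frame 0) ^ ∑ j, c.coord a j =
      z (c.frame 0) * ∏ j, z (c.frame j.succ) ^ c.coord a j := by
  have hmem : X a * X (c.frame 0) ^ (∑ j, c.coord a j) -
      X (c.frame 0) * ∏ j, X (c.frame j.succ) ^ c.coord a j ∈ coneIdeal k A := by
    rw [mem_coneIdeal_iff]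
    simp only [monomialHom, map_sub, map_mul, map_pow, map_prod, aeval_X, monomial_pow, one_pow,
      monomial_mul, mul_one, ← monomial_sum_one]
    rw [c.rel, sub_self]
  simpa [sub_eq_zero] using hz _ hmem

theorem eq_of_isConePoint {z z' : A → R} (hz : IsConePoint k A z) (hz' : IsConePoint k A z')
    (hu : IsUnit (z (c.frame 0))) (h : ∀ i, z (c.frame i) = z' (c.frame i)) : z = z' := by
  funext a
  refine (hu.pow (∑ j, c.coord a j)).mul_right_cancel ?_
  rw [mul_pow_eq_of_isConePoint hz, h 0, mul_pow_eq_of_isConePoint hz']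
  simp only [h]

theorem exists_isConePoint (w : Fin (n + 1) → R) (hw : IsUnit (w 0)) :
    ∃ z : A → R, IsConePoint k A z ∧ ∀ i, z (c.frame i) = w i := by
  obtain ⟨u, hu⟩ := hw
  refine ⟨c.param (Fin.cons (w 0) fun j => ↑u⁻¹ * w j.succ), c.isConePoint_param _, fun i => ?_⟩
  refine Fin.cases ?_ (fun j => ?_) i
  · rw [param_frame_zero, Fin.cons_zero]
  · rw [param_frame_succ, Fin.cons_zero, Fin.cons_succ, ← hu, Units.mul_inv_cancel_left]

end Points

variable [Infinite k] {c}

/-- Tangent vectors are points over the dual numbers, and these are determined by, and exist for,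
arbitrary values of the coordinates of a chart. -/
theorem rank_tangentSpace {y : A → k} (hy : y ∈ zeroLocus k (coneIdeal k A))
    (hy0 : y (c.frame 0) ≠ 0) : Module.rank k (tangentSpace A y) = n + 1 := by
  let π : tangentSpace A y →ₗ[k] Fin (n + 1) → k :=
    (LinearMap.funLeft k k c.frame).domRestrict (tangentSpace A y)
  let lift (v : A → k) : A → DualNumber k := fun a => (y a, v a)
  have hlift {v : A → k} : IsConePoint k A (lift v) ↔ v ∈ tangentSpace A y :=
    isConePoint_dualNumber_iff.trans (and_iff_right hy)
  have hunit {w : DualNumber k} (hw : w.fst = y (c.frame 0)) : IsUnit w :=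
    TrivSqZeroExt.isUnit_iff_isUnit_fst.2 (hw ▸ hy0.isUnit)
  have hinj : Function.Injective π := fun v v' hvv' => by
    have h := eq_of_isConePoint (hlift.2 v.2) (hlift.2 v'.2) (hunit rfl) fun i =>
      Prod.ext rfl (congrFun hvv' i)
    exact Subtype.ext (funext fun a => congrArg TrivSqZeroExt.snd (congrFun h a))
  have hsurj : Function.Surjective π := fun w => by
    obtain ⟨z, hz, hzw⟩ := exists_isConePoint (k := k) (c := c)
      (R := DualNumber k) (fun i => (y (c.frame i), w i)) (hunit rfl)
    have hfst : (fun a => (z a).fst) = y :=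
      eq_of_isConePoint (c := c) (k := k) (isConePoint_dualNumber_iff.1 hz).1 hy
        (by rw [hzw]; exact hy0.isUnit) fun i => congrArg TrivSqZeroExt.fst (hzw i)
    exact ⟨⟨fun a => (z a).snd, hfst ▸ (isConePoint_dualNumber_iff.1 hz).2⟩,
      funext fun i => congrArg TrivSqZeroExt.snd (hzw i)⟩
  rw [(LinearEquiv.ofBijective π ⟨hinj, hsurj⟩).rank_eq, rank_fin_fun, Nat.cast_succ]

theorem algebraicIndependent_frame (c : Chart A) : AlgebraicIndependent k fun i =>
    Ideal.Quotient.mkₐ k (coneIdeal k A) (X (c.frame i)) := by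
  rw [algebraicIndependent_iff]
  intro f hf
  have hmem : rename c.frame f ∈ coneIdeal k A := by
    rw [← Ideal.Quotient.eq_zero_iff_mem, ← hf, ← Ideal.Quotient.mkₐ_eq_mk k,
      ← AlgHom.comp_apply]
    exact DFunLike.congr_fun (algHom_ext fun i => by simp) f
  rw [mem_coneIdeal_iff, monomialHom, aeval_rename] at hmem
  have hinj : Function.Injective (Finsupp.linearCombination ℕ fun i => intVector (c.frame i).1) :=
    linearIndependent_nat c.linearIndependent
  have hid : monomialHom (fun i => Finsupp.single i 1) f = 0 :=
    (monomialHom_eq_zero_iff intVector_injective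
      (T' := (Finsupp.linearCombination ℕ fun i => intVector (c.frame i).1).toAddMonoidHom) hinj
      (fun i => by simp) f).1 hmem
  simpa [monomialHom, ← X.eq_def] using hid

theorem trdeg_quotient_coneIdeal (c : Chart A) :
    Algebra.trdeg k (MvPolynomial A k ⧸ coneIdeal k A) = n + 1 := by
  apply le_antisymm
  · let φ : (MvPolynomial A k ⧸ coneIdeal k A) →ₐ[k] MvPolynomial (Fin (n + 1)) k :=
      Ideal.Quotient.liftₐ _ (monomialHom fun a : A => a.1) fun _ => mem_coneIdeal_iff.1
    have hφ : Function.Injective φ := RingHom.lift_injective_of_ker_le_ideal _ _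
      fun _ => mem_coneIdeal_iff.2
    simpa using trdeg_le_of_injective φ hφ
  · simpa using (c.algebraicIndependent_frame (k := k)).lift_cardinalMk_le_trdeg

end Chart

theorem isSmoothToric_of_charts [Infinite k] {A : Finset (Fin (n + 1) →₀ ℕ)}
    (h : ∀ y ∈ zeroLocus k (coneIdeal k A), y ≠ 0 → ∃ c : Chart A, y (c.frame 0) ≠ 0) :
    IsSmoothToric k A := fun y hy hy0 => by
  obtain ⟨c, hc⟩ := h y hy hy0
  rw [Chart.rank_tangentSpace hy hc, c.trdeg_quotient_coneIdeal]

/-! ### Hexagons -/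

/-- On the cone `y_a ^ (p + q) = y_b ^ p * y_c ^ q`, so that at a nonzero point some coordinate
belonging to a vertex of the Newton polygon does not vanish. -/
theorem ne_zero_or_ne_zero_of_mem_zeroLocus [Infinite k] {A : Finset (Fin (n + 1) →₀ ℕ)}
    {y : A → k} (hy : y ∈ zeroLocus k (coneIdeal k A)) {a b c : A} {p q : ℕ} (hpq : 0 < p + q)
    (habc : (p + q) • a.1 = p • b.1 + q • c.1) (ha : y a ≠ 0) : y b ≠ 0 ∨ y c ≠ 0 := by
  by_contra! hbc
  have hmem : X a ^ (p + q) - X b ^ p * X c ^ q ∈ coneIdeal k A := by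
    rw [mem_coneIdeal_iff]
    simp [monomialHom, monomial_pow, monomial_mul, habc]
  have h := mem_zeroLocus_iff.1 hy _ hmem
  simp only [map_sub, map_mul, map_pow, aeval_X, hbc.1, hbc.2, ← pow_add, zero_pow hpq.ne',
    sub_zero] at h
  exact pow_ne_zero _ ha h

section Permuted

variable (σ : Equiv.Perm (Fin (2 + 1)))

/-- The exponent with the entries `a`, `b`, `c` at the positions `σ 0`, `σ 1`, `σ 2`. -/
def expoAt (a b c : ℕ) : Fin (2 + 1) →₀ ℕ :=
  (expo a b c).equivMapDomain σ

@[simp]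
theorem expoAt_apply_zero (a b c : ℕ) : expoAt σ a b c (σ 0) = a := by
  simp [expoAt]

@[simp]
theorem expoAt_apply_one (a b c : ℕ) : expoAt σ a b c (σ 1) = b := by
  simp [expoAt]

@[simp]
theorem expoAt_apply_two (a b c : ℕ) : expoAt σ a b c (σ 2) = c := by
  simp [expoAt]

theorem expoAt_mul (τ : Equiv.Perm (Fin (2 + 1))) (a b c : ℕ) :
    expoAt (σ * τ) a b c = (expoAt τ a b c).equivMapDomain σ :=
  Finsupp.equivMapDomain_trans τ σ _

theorem expoAt_mul_swap_zero_one (a b c : ℕ) :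
    expoAt (σ * Equiv.swap 0 1) a b c = expoAt σ b a c := by
  rw [expoAt_mul, expoAt]
  congr 1
  ext i
  fin_cases i <;> rfl

theorem expoAt_mul_swap_one_two (a b c : ℕ) :
    expoAt (σ * Equiv.swap 1 2) a b c = expoAt σ a c b := by
  rw [expoAt_mul, expoAt]
  congr 1
  ext i
  fin_cases i <;> rfl

theorem forall_iff_perm {P : Fin (2 + 1) → Prop} : (∀ i, P i) ↔ P (σ 0) ∧ P (σ 1) ∧ P (σ 2) := by
  rw [← σ.forall_congr_right, Fin.forall_fin_succ, Fin.forall_fin_two]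
  rfl

theorem ext_iff_perm {a b : Fin (2 + 1) →₀ ℕ} :
    a = b ↔ a (σ 0) = b (σ 0) ∧ a (σ 1) = b (σ 1) ∧ a (σ 2) = b (σ 2) :=
  DFunLike.ext_iff.trans (forall_iff_perm σ)

theorem degree_eq_perm (a : Fin (2 + 1) →₀ ℕ) :
    a.degree = a (σ 0) + a (σ 1) + a (σ 2) := by
  rw [Finsupp.degree_eq_sum, ← Equiv.sum_comp σ]
  exact Fin.sum_univ_three _

end Permuted

variable {d : ℕ} {h : Fin (2 + 1) → ℕ}

/-- The lattice points of the triangle of exponents of degree `d`, with a triangle of side `h i`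
cut off at the `i`-th vertex. -/
def hexagon (d : ℕ) (h : Fin (2 + 1) → ℕ) : Set (Fin (2 + 1) →₀ ℕ) :=
  {a | a.degree = d ∧ ∀ i, a i + h i ≤ d}

/-- The lattice points on the six sides of `hexagon d h`. -/
def hexagonBoundary (d : ℕ) (h : Fin (2 + 1) → ℕ) : Set (Fin (2 + 1) →₀ ℕ) :=
  {a ∈ hexagon d h | ∃ i, a i = 0 ∨ a i + h i = d}

/-- The vertices of `hexagon d h`, one for each permutation of the coordinates. -/
def hexagonVertex (d : ℕ) (h : Fin (2 + 1) → ℕ) (σ : Equiv.Perm (Fin (2 + 1))) :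
    Fin (2 + 1) →₀ ℕ :=
  expoAt σ 0 (h (σ 2)) (d - h (σ 2))

/-- None of the six sides of `hexagon d h` reduces to a point. -/
structure IsProperHexagon (d : ℕ) (h : Fin (2 + 1) → ℕ) : Prop where
  one_le : ∀ i, 1 ≤ h i
  add_lt : ∀ i j, i ≠ j → h i + h j < d

theorem mem_hexagon_iff (σ : Equiv.Perm (Fin (2 + 1))) {a : Fin (2 + 1) →₀ ℕ} :
    a ∈ hexagon d h ↔ a (σ 0) + a (σ 1) + a (σ 2) = d ∧
      a (σ 0) + h (σ 0) ≤ d ∧ a (σ 1) + h (σ 1) ≤ d ∧ a (σ 2) + h (σ 2) ≤ d := by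
  rw [hexagon, Set.mem_ofPred_eq, degree_eq_perm σ, forall_iff_perm σ]

theorem exists_vertices_segment_of_apply_eq_zero (hh : IsProperHexagon d h)
    {a : Fin (2 + 1) →₀ ℕ} (ha : a ∈ hexagon d h) (σ : Equiv.Perm (Fin (2 + 1)))
    (hσ : a (σ 0) = 0) : ∃ p q : ℕ, 0 < p + q ∧ (p + q) • a =
      p • hexagonVertex d h σ + q • hexagonVertex d h (σ * Equiv.swap 1 2) := by
  have hlt := hh.add_lt (σ 1) (σ 2) (by simp)
  rw [mem_hexagon_iff σ] at ha
  obtain ⟨p, hp⟩ : ∃ p, a (σ 2) = h (σ 1) + p := ⟨a (σ 2) - h (σ 1), by omega⟩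
  obtain ⟨q, hq⟩ : ∃ q, a (σ 1) = h (σ 2) + q := ⟨a (σ 1) - h (σ 2), by omega⟩
  refine ⟨p, q, by omega, (ext_iff_perm σ).2 ?_⟩
  have h1 : d - h (σ 1) = p + q + h (σ 2) := by omega
  have h2 : d - h (σ 2) = p + q + h (σ 1) := by omega
  have hτ : hexagonVertex d h (σ * Equiv.swap 1 2) = expoAt σ 0 (d - h (σ 1)) (h (σ 1)) := by
    simp [hexagonVertex, expoAt_mul_swap_one_two]
  rw [hτ, hexagonVertex, h1, h2]
  simp only [Finsupp.add_apply, Finsupp.smul_apply, smul_eq_mul,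
    expoAt_apply_zero, expoAt_apply_one, expoAt_apply_two, hσ, hp, hq]
  refine ⟨?_, ?_, ?_⟩ <;> ring

theorem exists_vertices_segment_of_apply_add_eq (hh : IsProperHexagon d h)
    {a : Fin (2 + 1) →₀ ℕ} (ha : a ∈ hexagon d h) (σ : Equiv.Perm (Fin (2 + 1)))
    (hσ : a (σ 2) + h (σ 2) = d) : ∃ p q : ℕ, 0 < p + q ∧ (p + q) • a =
      p • hexagonVertex d h σ + q • hexagonVertex d h (σ * Equiv.swap 0 1) := by
  have hone := hh.one_le (σ 2)
  rw [mem_hexagon_iff σ] at ha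
  refine ⟨a (σ 1), a (σ 0), by omega, (ext_iff_perm σ).2 ?_⟩
  have h1 : h (σ 2) = a (σ 0) + a (σ 1) := by omega
  have h2 : d - h (σ 2) = a (σ 2) := by omega
  have hτ : hexagonVertex d h (σ * Equiv.swap 0 1) = expoAt σ (h (σ 2)) 0 (d - h (σ 2)) := by
    simp [hexagonVertex, expoAt_mul_swap_zero_one, Equiv.swap_apply_of_ne_of_ne]
  rw [hτ, hexagonVertex, h2, h1]
  simp only [Finsupp.add_apply, Finsupp.smul_apply, smul_eq_mul,
    expoAt_apply_zero, expoAt_apply_one, expoAt_apply_two]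
  refine ⟨?_, ?_, ?_⟩ <;> ring

theorem exists_vertices_segment (hh : IsProperHexagon d h) {a : Fin (2 + 1) →₀ ℕ}
    (ha : a ∈ hexagonBoundary d h) : ∃ (σ τ : Equiv.Perm (Fin (2 + 1))) (p q : ℕ), 0 < p + q ∧
      (p + q) • a = p • hexagonVertex d h σ + q • hexagonVertex d h τ := by
  obtain ⟨ha, i, hi | hi⟩ := ha
  · exact ⟨_, _, exists_vertices_segment_of_apply_eq_zero hh ha (Equiv.swap 0 i) (by simpa)⟩
  · exact ⟨_, _, exists_vertices_segment_of_apply_add_eq hh ha (Equiv.swap 2 i) (by simpa)⟩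

theorem exists_boundary_segment {a : Fin (2 + 1) →₀ ℕ} (ha : a ∈ hexagon d h) :
    ∃ b ∈ hexagonBoundary d h, ∃ c ∈ hexagonBoundary d h, ∃ p q : ℕ, 0 < p + q ∧
      (p + q) • a = p • b + q • c := by
  by_cases hb : a ∈ hexagonBoundary d h
  · exact ⟨a, hb, a, hb, 1, 0, one_pos, by simp⟩
  have hlt : ∀ i, 0 < a i ∧ a i + h i < d := fun i => by
    have hi := ha.2 i
    have hi' := not_exists.1 (not_and.1 hb ha) i
    omega
  have h1 := hlt 1
  have h2 := hlt 2
  rw [mem_hexagon_iff 1] at ha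
  simp only [Equiv.Perm.one_apply] at ha
  let s := min (a 2) (d - h 1 - a 1)
  let t := min (a 1) (d - h 2 - a 2)
  refine ⟨expo (a 0) (a 1 + s) (a 2 - s), ⟨(mem_hexagon_iff 1).2 ?_, ?_⟩,
    expo (a 0) (a 1 - t) (a 2 + t), ⟨(mem_hexagon_iff 1).2 ?_, ?_⟩, t, s, by omega,
    (ext_iff_perm 1).2 ?_⟩
  · simp only [Equiv.Perm.one_apply, expo_apply_zero, expo_apply_one, expo_apply_two]
    omega
  · by_cases hs : s = a 2
    · exact ⟨2, Or.inl (by simp [hs])⟩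
    · exact ⟨1, Or.inr (by simp; omega)⟩
  · simp only [Equiv.Perm.one_apply, expo_apply_zero, expo_apply_one, expo_apply_two]
    omega
  · by_cases ht : t = a 1
    · exact ⟨1, Or.inl (by simp [ht])⟩
    · exact ⟨2, Or.inr (by simp; omega)⟩
  · obtain ⟨u, hu⟩ : ∃ u, a 2 = s + u := ⟨a 2 - s, by omega⟩
    obtain ⟨v, hv⟩ : ∃ v, a 1 = t + v := ⟨a 1 - t, by omega⟩
    simp only [Equiv.Perm.one_apply, Finsupp.add_apply, Finsupp.smul_apply, smul_eq_mul,
      expo_apply_zero, expo_apply_one, expo_apply_two, hu, hv, Nat.add_sub_cancel_left]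
    refine ⟨?_, ?_, ?_⟩ <;> ring

section

variable {A : Finset (Fin (2 + 1) →₀ ℕ)}

theorem hexagonVertex_mem (hh : IsProperHexagon d h) (σ : Equiv.Perm (Fin (2 + 1))) :
    hexagonVertex d h σ ∈ hexagonBoundary d h := by
  have h12 := hh.add_lt (σ 1) (σ 2) (by simp)
  have h02 := hh.add_lt (σ 0) (σ 2) (by simp)
  refine ⟨(mem_hexagon_iff σ).2 ?_, σ 0, Or.inl ?_⟩
  · simp only [hexagonVertex, expoAt_apply_zero, expoAt_apply_one, expoAt_apply_two]
    omega
  · simp [hexagonVertex]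

theorem exists_hexagonVertex_ne_zero [Infinite k] (hh : IsProperHexagon d h)
    (hA : hexagonBoundary d h ⊆ A) (hA' : (A : Set (Fin (2 + 1) →₀ ℕ)) ⊆ hexagon d h) {y : A → k}
    (hy : y ∈ zeroLocus k (coneIdeal k A)) (hy0 : y ≠ 0) :
    ∃ σ, y ⟨hexagonVertex d h σ, hA (hexagonVertex_mem hh σ)⟩ ≠ 0 := by
  obtain ⟨a, ha⟩ := Function.ne_iff.1 hy0
  obtain ⟨b, hb, hyb⟩ : ∃ b, ∃ hb : b ∈ hexagonBoundary d h, y ⟨b, hA hb⟩ ≠ 0 := by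
    obtain ⟨b, hb, c, hc, p, q, hpq, hseg⟩ := exists_boundary_segment (hA' a.2)
    exact (ne_zero_or_ne_zero_of_mem_zeroLocus hy (b := ⟨b, hA hb⟩) (c := ⟨c, hA hc⟩) hpq hseg
      ha).elim (fun h => ⟨b, hb, h⟩) fun h => ⟨c, hc, h⟩
  obtain ⟨σ, τ, p, q, hpq, hseg⟩ := exists_vertices_segment hh hb
  exact (ne_zero_or_ne_zero_of_mem_zeroLocus hy (a := ⟨b, hA hb⟩)
    (b := ⟨_, hA (hexagonVertex_mem hh σ)⟩) (c := ⟨_, hA (hexagonVertex_mem hh τ)⟩) hpq hseg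
    hyb).elim (fun h => ⟨σ, h⟩) fun h => ⟨τ, h⟩

/-- The exponents at a vertex of `hexagon d h` and next to it on the two sides through it. -/
def hexagonFrame (d : ℕ) (h : Fin (2 + 1) → ℕ) (σ : Equiv.Perm (Fin (2 + 1))) :
    Fin (2 + 1) → Fin (2 + 1) →₀ ℕ :=
  ![hexagonVertex d h σ, expoAt σ 1 (h (σ 2) - 1) (d - h (σ 2)),
    expoAt σ 0 (h (σ 2) + 1) (d - h (σ 2) - 1)]

theorem hexagonFrame_mem (hh : IsProperHexagon d h) (σ : Equiv.Perm (Fin (2 + 1)))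
    (i : Fin (2 + 1)) : hexagonFrame d h σ i ∈ hexagonBoundary d h := by
  have h2 := hh.one_le (σ 2)
  have h12 := hh.add_lt (σ 1) (σ 2) (by simp)
  have h02 := hh.add_lt (σ 0) (σ 2) (by simp)
  revert i
  rw [forall_iff_perm 1]
  refine ⟨hexagonVertex_mem hh σ, ⟨(mem_hexagon_iff σ).2 ?_, σ 2, Or.inr ?_⟩,
    ⟨(mem_hexagon_iff σ).2 ?_, σ 0, Or.inl ?_⟩⟩ <;>
  simp only [hexagonFrame, Equiv.Perm.one_apply, Matrix.cons_val, expoAt_apply_zero,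
    expoAt_apply_one, expoAt_apply_two] <;> omega

theorem linearIndependent_hexagonFrame (hh : IsProperHexagon d h) (σ : Equiv.Perm (Fin (2 + 1))) :
    LinearIndependent ℤ fun i => intVector (hexagonFrame d h σ i) := by
  have hone := hh.one_le (σ 2)
  have hlt := hh.add_lt (σ 1) (σ 2) (by simp)
  obtain ⟨r, hr⟩ : ∃ r, h (σ 2) = r + 1 := ⟨h (σ 2) - 1, by omega⟩
  obtain ⟨s, hs⟩ : ∃ s, d - h (σ 2) = s + 1 := ⟨d - h (σ 2) - 1, by omega⟩
  rw [Fintype.linearIndependent_iff]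
  intro g hg
  obtain ⟨h0, h1, h2⟩ := (forall_iff_perm σ).1 (congrFun hg)
  rw [Finset.sum_apply, Fin.sum_univ_three] at h0 h1 h2
  simp only [hexagonFrame, hexagonVertex, hs] at h0 h1 h2
  simp only [intVector, hr, Nat.add_sub_cancel, Matrix.cons_val, AddMonoidHom.coe_mk,
    ZeroHom.coe_mk, Pi.smul_apply, Pi.zero_apply, smul_eq_mul, expoAt_apply_zero,
    expoAt_apply_one, expoAt_apply_two] at h0 h1 h2
  push_cast at h0 h1 h2
  replace h0 : g 1 = 0 := by linear_combination h0
  have hsum : g 0 + g 2 = 0 := by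
    have : (g 0 + g 2) * (r + s + 2) = 0 := by linear_combination h1 + h2 - (r + s + 1) * h0
    exact (mul_eq_zero.1 this).resolve_right (by positivity)
  have hg2 : g 2 = 0 := by linear_combination h1 - (r + 1) * hsum - r * h0
  have hg0 : g 0 = 0 := by linear_combination hsum - hg2
  exact (forall_iff_perm 1).2 ⟨hg0, h0, hg2⟩

/-- The chart at a vertex of a hexagon: the two sides through the vertex start with a basis of the
lattice. -/
def hexagonChart (hh : IsProperHexagon d h) (hA : hexagonBoundary d h ⊆ A)
    (hA' : (A : Set (Fin (2 + 1) →₀ ℕ)) ⊆ hexagon d h) (σ : Equiv.Perm (Fin (2 + 1))) :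
    Chart A where
  frame i := ⟨hexagonFrame d h σ i, hA (hexagonFrame_mem hh σ i)⟩
  coord a := Finsupp.equivFunOnFinite.symm ![a.1 (σ 0), d - h (σ 2) - a.1 (σ 2)]
  linearIndependent := linearIndependent_hexagonFrame hh σ
  rel a := by
    have hone := hh.one_le (σ 2)
    have hlt := hh.add_lt (σ 1) (σ 2) (by simp)
    have ha := (mem_hexagon_iff σ).1 (hA' a.2)
    obtain ⟨r, hr⟩ : ∃ r, h (σ 2) = r + 1 := ⟨h (σ 2) - 1, by omega⟩
    obtain ⟨s, hs⟩ : ∃ s, d - h (σ 2) = s + 1 := ⟨d - h (σ 2) - 1, by omega⟩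
    obtain ⟨q, hq⟩ : ∃ q, s + 1 - a.1 (σ 2) = q := ⟨_, rfl⟩
    have h1 : a.1 (σ 1) + a.1 (σ 0) = r + 1 + q := by omega
    have h2 : a.1 (σ 2) + q = s + 1 := by omega
    refine (ext_iff_perm σ).2 ⟨?_, ?_, ?_⟩ <;>
      simp only [Fin.sum_univ_two, hexagonFrame, hexagonVertex, hs, hq]
    · simp
    · simp only [Finsupp.equivFunOnFinite_symm_apply_apply, Matrix.cons_val, Finsupp.add_apply,
        Finsupp.smul_apply, smul_eq_mul, expoAt_apply_one, Fin.succ_zero_eq_one,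
        Fin.succ_one_eq_two, hr, Nat.add_sub_cancel]
      linear_combination h1
    · simp only [Finsupp.equivFunOnFinite_symm_apply_apply, Matrix.cons_val, Finsupp.add_apply,
        Finsupp.smul_apply, smul_eq_mul, expoAt_apply_two, Fin.succ_zero_eq_one,
        Fin.succ_one_eq_two, Nat.add_sub_cancel]
      linear_combination h2

theorem isSmoothToric_of_hexagonBoundary_subset [Infinite k] (hh : IsProperHexagon d h)
    (hA : hexagonBoundary d h ⊆ A) (hA' : (A : Set (Fin (2 + 1) →₀ ℕ)) ⊆ hexagon d h) :
    IsSmoothToric k A := isSmoothToric_of_charts fun _ hy hy0 =>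
  let ⟨σ, hσ⟩ := exists_hexagonVertex_ne_zero hh hA hA' hy hy0
  ⟨hexagonChart hh hA hA' σ, hσ⟩

end

/-! ### The bounds and the explicit systems -/

theorem mem_apolarExponents {d : ℕ} {S : Finset (Fin (n + 1) →₀ ℕ)} (hS : ∀ a ∈ S, a.degree = d)
    {a : Fin (n + 1) →₀ ℕ} :
    a ∈ apolarExponents d (monomialIdeal k S) ↔ a.degree = d ∧ a ∉ S := by
  simp only [apolarExponents, Finset.mem_filter, Finset.mem_finsuppAntidiag, Finset.subset_univ,
    and_true, ← Finsupp.degree_eq_sum]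
  exact and_congr_right fun ha => not_congr (monomial_mem_monomialIdeal_iff hS ha)

theorem mem_pureExponents_iff_exists_le {d : ℕ} {a : Fin (n + 1) →₀ ℕ} (ha : a.degree = d) :
    a ∈ pureExponents n d ↔ ∃ i, d ≤ a i := by
  rw [mem_pureExponents]
  refine exists_congr fun i => ⟨?_, fun hi => ?_⟩
  · rintro rfl
    simp
  · exact eq_of_le_of_degree_eq (Finsupp.single_le_iff.2 hi) (by rw [Finsupp.degree_single, ha])

theorem isProperHexagon_corner {d : ℕ} (hd : 4 ≤ d) : IsProperHexagon d ![2, 1, 1] where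
  one_le := by decide
  add_lt i j hij := by
    fin_cases i <;> fin_cases j <;> first | exact absurd rfl hij | (simp; omega)

theorem coe_apolarExponents_cornerExponents {d : ℕ} (hd : 0 < d) :
    (apolarExponents d (monomialIdeal k (cornerExponents d)) : Set (Fin (2 + 1) →₀ ℕ)) =
      hexagon d ![2, 1, 1] := by
  ext a
  rw [Finset.mem_coe, mem_apolarExponents fun a ha => degree_of_mem_cornerExponents hd ha]
  refine and_congr_right fun ha => ?_
  rw [cornerExponents, Finset.mem_union, mem_pureExponents_iff_exists_le ha, not_or, not_exists,
    forall_iff_perm 1, forall_iff_perm 1, Finset.mem_insert, Finset.mem_singleton,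
    ext_iff_perm 1, ext_iff_perm 1]
  rw [degree_eq_perm 1] at ha
  simp only [Equiv.Perm.one_apply, expo_apply_zero, expo_apply_one, expo_apply_two,
    Matrix.cons_val] at ha ⊢
  omega

theorem isSmoothToric_cornerExponents [Infinite k] {d : ℕ} (hd : 4 ≤ d) :
    IsSmoothToric k (apolarExponents d (monomialIdeal k (cornerExponents d))) := by
  have hA := coe_apolarExponents_cornerExponents (k := k) (by omega : 0 < d)
  refine isSmoothToric_of_hexagonBoundary_subset (isProperHexagon_corner hd) ?_ hA.le
  exact hA ▸ Set.sep_subset _ _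

theorem isSmoothToric_stripExponents [Infinite k] {e m : ℕ} (he : 2 ≤ e) :
    IsSmoothToric k (apolarExponents (e + m + 2) (monomialIdeal k (stripExponents e m))) := by
  have hmem {a : Fin (2 + 1) →₀ ℕ} :=
    mem_apolarExponents (k := k) (a := a) fun _ => degree_of_mem_stripExponents (e := e) (m := m)
  have hproper : IsProperHexagon (e + m + 2) fun _ => 1 := ⟨fun _ => le_rfl, fun _ _ _ => by omega⟩
  refine isSmoothToric_of_hexagonBoundary_subset hproper ?_ ?_
  · rintro a ⟨⟨ha, hle⟩, i, hi⟩
    refine hmem.2 ⟨ha, fun haS => ?_⟩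
    rw [stripExponents, Finset.mem_union, mem_pureExponents_iff_exists_le ha] at haS
    rcases haS with ⟨j, hj⟩ | hin
    · exact absurd (hle j) (Nat.not_le.2 (Nat.lt_succ_of_le hj))
    · have hpos := le_of_mem_innerExponents hin
      have hne : ∀ j, ¬(a j = 0 ∨ a j + 1 = e + m + 2) := by
        rw [degree_eq_perm 1] at ha
        rw [forall_iff_perm 1]
        simp only [Equiv.Perm.one_apply] at ha ⊢
        omega
      exact hne i hi
  · intro a ha
    obtain ⟨hdeg, haS⟩ := hmem.1 ha
    have hp : ¬∃ i, e + m + 2 ≤ a i := fun h =>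
      haS (Finset.mem_union_left _ ((mem_pureExponents_iff_exists_le hdeg).2 h))
    exact ⟨hdeg, fun i => Nat.lt_of_not_ge (not_exists.1 hp i)⟩

theorem five_le_numGens [CharZero k] {d : ℕ} (hd : 4 ≤ d)
    {I : Ideal (MvPolynomial (Fin (2 + 1)) k)} (hI : I ∈ systems k 2 d) : 5 ≤ numGens I := by
  obtain ⟨S, hS, rfl, hTog, -⟩ := hI
  rw [numGens_monomialIdeal hS]
  exact five_le_card_of_isTogliatti hd hS hTog

theorem numGens_le {d : ℕ} {I : Ideal (MvPolynomial (Fin (2 + 1)) k)} (hI : I ∈ systems k 2 d) :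
    numGens I ≤ d + 1 := by
  obtain ⟨-, -, -, hTog, -⟩ := hI
  simpa [add_comm 2 d] using numGens_le_of_isTogliatti hTog

theorem explicitIdeal_mem [CharZero k] {d r : ℕ} (hd : 4 ≤ d) (hr : 5 ≤ r) (hrd : r ≤ d + 1) :
    explicitIdeal k d r ∈ smoothSystems k 2 d ∧ numGens (explicitIdeal k d r) = r := by
  have : Infinite k := Infinite.of_injective _ (Nat.cast_injective (R := k))
  rcases hr.eq_or_lt with rfl | hr
  · rw [explicitIdeal_five,
      numGens_monomialIdeal fun a ha => degree_of_mem_cornerExponents (by omega : 0 < d) ha]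
    exact ⟨⟨isMinimalMonomialTogliatti_cornerExponents hd, isSmoothToric_cornerExponents hd⟩,
      card_cornerExponents (by omega)⟩
  · obtain ⟨m, rfl⟩ : ∃ m, r = m + 5 := ⟨r - 5, by omega⟩
    obtain ⟨e, rfl⟩ : ∃ e, d = e + m + 2 := ⟨d - m - 2, by omega⟩
    have hm : 0 < m := by omega
    have he : 2 ≤ e := by omega
    rw [explicitIdeal_strip hm, numGens_monomialIdeal fun a => degree_of_mem_stripExponents]
    exact ⟨⟨isMinimalMonomialTogliatti_stripExponents hm he, isSmoothToric_stripExponents he⟩,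
      card_stripExponents hm⟩

end Togliatti

end

theorem proposition4p1_general {k : Type*} [Field k] [CharZero k] (d : ℕ) (hd : 4 ≤ d) :
    (IsLeast (Togliatti.numGens '' Togliatti.smoothSystems k 2 d) 5 ∧
      IsLeast (Togliatti.numGens '' Togliatti.systems k 2 d) 5) ∧
    (IsGreatest (Togliatti.numGens '' Togliatti.smoothSystems k 2 d) (d + 1) ∧
      IsGreatest (Togliatti.numGens '' Togliatti.systems k 2 d) (d + 1)) ∧
    ∀ r : ℕ, 5 ≤ r → r ≤ d + 1 →
      Togliatti.explicitIdeal k d r ∈ Togliatti.smoothSystems k 2 d ∧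
        Togliatti.numGens (Togliatti.explicitIdeal k d r) = r := by
  have hmem := fun r => Togliatti.explicitIdeal_mem (k := k) (r := r) hd
  obtain ⟨hfive, hfive_card⟩ := hmem 5 le_rfl (by omega)
  obtain ⟨hmax, hmax_card⟩ := hmem (d + 1) (by omega) le_rfl
  have hlower : 5 ∈ lowerBounds (Togliatti.numGens '' Togliatti.systems k 2 d) :=
    Set.forall_mem_image.2 fun _ => Togliatti.five_le_numGens hd
  have hupper : d + 1 ∈ upperBounds (Togliatti.numGens '' Togliatti.systems k 2 d) :=
    Set.forall_mem_image.2 fun _ => Togliatti.numGens_le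
  have hsub : Togliatti.numGens '' Togliatti.smoothSystems k 2 d ⊆
      Togliatti.numGens '' Togliatti.systems k 2 d := Set.image_mono fun _ hI => hI.1
  exact ⟨⟨⟨⟨_, hfive, hfive_card⟩, lowerBounds_mono_set hsub hlower⟩,
      ⟨_, hfive.1, hfive_card⟩, hlower⟩,
    ⟨⟨⟨_, hmax, hmax_card⟩, upperBounds_mono_set hsub hupper⟩, ⟨_, hmax.1, hmax_card⟩, hupper⟩,
    hmem⟩

theorem proposition4p1 {k : Type*} [Field k] [IsAlgClosed k] [CharZero k] (d : ℕ) (hd : 4 ≤ d) :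
    (IsLeast (Togliatti.numGens '' Togliatti.smoothSystems k 2 d) 5 ∧
      IsLeast (Togliatti.numGens '' Togliatti.systems k 2 d) 5) ∧
    (IsGreatest (Togliatti.numGens '' Togliatti.smoothSystems k 2 d) (d + 1) ∧
      IsGreatest (Togliatti.numGens '' Togliatti.systems k 2 d) (d + 1)) ∧
    ∀ r : ℕ, 5 ≤ r → r ≤ d + 1 →
      Togliatti.explicitIdeal k d r ∈ Togliatti.smoothSystems k 2 d ∧
        Togliatti.numGens (Togliatti.explicitIdeal k d r) = r := by
  exact proposition4p1_general d hd
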